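/- Theorem 1. Let the butterfly network be the network with input nodes $i_1,i_2$, output nodes $o_1,o_2$, repeater nodes $n_1,n_2$ and the seven edges $i_1o_1,\ i_1n_1,\ i_2o_2,\ i_2n_1,\ n_1n_2,\ n_2o_1,\ n_2o_2$. Let $|\Phi\rangle$ be the resource state that consists of one Bell pair $\frac{1}{\sqrt2}(|00\rangle+|11\rangle)$ for each edge, shared between the two end nodes of that edge. Classical communication between the nodes is free. Then every two-qubit unitary operation is deterministically implementable over the butterfly network, that is: for every unitary $U$ on $\mathbb{C}^2\otimes\mathbb{C}^2$ there is an LOCC map $\Gamma$ (finitely many rounds of local quantum instruments at the nodes, ancillas and discarding included, where all outcomes are announced to all nodes and later local operations may depend on them) such that, for every two-qubit pure state $|\psi\rangle$ given with its first qubit at $i_1$ and its second qubit at $i_2$, $$\Gamma\bigl(|\psi\rangle\langle\psi|\otimes|\Phi\rangle\langle\Phi|\bigr)=U|\psi\rangle\langle\psi|U^{\dagger},$$ where the first output qubit is at $o_1$ and the second is at $o_2$. -/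

import Mathlib

open scoped Matrix

noncomputable section

namespace QuantumNetwork

/-- Operators on the composite system of the parties `v : V`, where the local Hilbert space of
party `v` has an orthonormal basis labelled by `d v`; the composite space `⨂ v, ℂ ^ (d v)` has the
product basis labelled by the tuples in `∀ v, d v`. -/
abbrev GlobalOp {V : Type} (d : V → Type) : Type :=
  Matrix (∀ v, d v) (∀ v, d v) ℂ

/-- The tensor product `⨂ v, A v` of local operators `A v : ℂ ^ (d v) → ℂ ^ (d' v)`. -/
def tensorOp {V : Type} [Fintype V] {d d' : V → Type} (A : ∀ v, Matrix (d' v) (d v) ℂ) :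
    Matrix (∀ v, d' v) (∀ v, d v) ℂ :=
  Matrix.of fun x y => ∏ v, A v (x v) (y v)

/-- `IsLOCC Γ`: the map `Γ` is realised by finitely many rounds of local operations and classical
communication between the parties `v : V`. In one round each party `v` performs a quantum
instrument with finitely many outcomes, given by Kraus operators `K v j` with
`∑ j, (K v j)ᴴ * K v j = 1` (a party that does nothing uses the single Kraus operator `1`; the
dimension may change, so attaching ancillas and discarding subsystems are included), all outcomes
are announced to all parties, and the rest of the protocol may depend on them. The record of
outcomes is forgotten at the end, i.e. the contributions of all branches are added up. -/
inductive IsLOCC {V : Type} [Fintype V] [DecidableEq V] :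
    {d e : V → Type} → (GlobalOp d → GlobalOp e) → Prop
  | idle {d : V → Type} : IsLOCC (fun ρ : GlobalOp d => ρ)
  | round {d d' e Out : V → Type}
      [∀ v, Fintype (d v)] [∀ v, DecidableEq (d v)] [∀ v, Fintype (d' v)] [∀ v, Fintype (Out v)]
      (K : ∀ v, Out v → Matrix (d' v) (d v) ℂ)
      (complete : ∀ v, ∑ j, (K v j)ᴴ * K v j = 1)
      (Λ : (∀ v, Out v) → GlobalOp d' → GlobalOp e)
      (next : ∀ j, IsLOCC (Λ j)) :
      IsLOCC (fun ρ : GlobalOp d =>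
        ∑ j : ∀ v, Out v,
          Λ j (tensorOp (fun v => K v (j v)) * ρ * (tensorOp (fun v => K v (j v)))ᴴ))

/-- A `k`-pair network with nodes `V` and edges `E`: the two end nodes of every edge, the node
holding the `i`-th input qubit and the node at which the `i`-th output qubit is to appear.
Since classical communication is free, edges need no direction. -/
structure Network (V E : Type) (k : ℕ) where
  ends : E → Fin 2 → V
  input : Fin k → V
  output : Fin k → V

/-- Labels for the computational basis of the local space of the node `v`, when the qubits `q : Q`
are distributed over the nodes by `loc`: the node `v` holds the qubits `q` with `loc q = v`. -/
abbrev LocalBasis {Q V : Type} (loc : Q → V) (v : V) : Type :=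
  {q : Q // loc q = v} → Fin 2

/-- The bit string over all qubits given by the local bit strings at the nodes. -/
def glue {Q V : Type} (loc : Q → V) (x : ∀ v, LocalBasis loc v) : Q → Fin 2 :=
  fun q => x (loc q) ⟨q, rfl⟩

/-- An operator on the qubits `Q`, in the computational basis, seen as an operator on the composite
system of the nodes. -/
def distribute {Q V : Type} (loc : Q → V) (ρ : Matrix (Q → Fin 2) (Q → Fin 2) ℂ) :
    GlobalOp (LocalBasis loc) :=
  ρ.submatrix (glue loc) (glue loc)

/-- The operator `|φ⟩⟨φ|`. -/
def ketbra {ι : Type} (φ : ι → ℂ) : Matrix ι ι ℂ :=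
  Matrix.vecMulVec φ (star φ)

/-- The Bell pair `(|00⟩ + |11⟩) / √2`: the amplitude at the basis vector `|a b⟩`. -/
def bell (a b : Fin 2) : ℂ :=
  if a = b then 1 / (Real.sqrt 2 : ℂ) else 0

namespace Network

variable {V E : Type} {k : ℕ}

/-- Where the qubits are at the beginning: the qubit `Sum.inl (e, s)` is the half at the end `s` of
the Bell pair of the edge `e`, and `Sum.inr i` is the `i`-th input qubit. -/
def startLoc (N : Network V E k) : (E × Fin 2) ⊕ Fin k → V
  | Sum.inl (e, s) => N.ends e s
  | Sum.inr i => N.input i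

/-- The initial vector: one Bell pair for each edge, and the input qubits in the state `ψ`. -/
def startVec [Fintype E] (ψ : (Fin k → Fin 2) → ℂ) : ((E × Fin 2) ⊕ Fin k → Fin 2) → ℂ :=
  fun x => (∏ e : E, bell (x (Sum.inl (e, 0))) (x (Sum.inl (e, 1)))) * ψ (fun i => x (Sum.inr i))

/-- The `k`-qubit operation `U` is deterministically implementable over the network `N`: there is
an LOCC map between the nodes which, assisted by one Bell pair per edge, takes every pure state
`|ψ⟩⟨ψ|` of the qubits at the input nodes to `U|ψ⟩⟨ψ|U†` at the output nodes. -/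
def DeterministicallyImplementable [Fintype V] [DecidableEq V] [Fintype E] (N : Network V E k)
    (U : Matrix (Fin k → Fin 2) (Fin k → Fin 2) ℂ) : Prop :=
  ∃ Γ : GlobalOp (LocalBasis N.startLoc) → GlobalOp (LocalBasis N.output),
    IsLOCC Γ ∧
    ∀ ψ : (Fin k → Fin 2) → ℂ, star ψ ⬝ᵥ ψ = 1 →
      Γ (distribute N.startLoc (ketbra (startVec ψ))) =
        distribute N.output (U * ketbra ψ * Uᴴ)

end Network

/-- The nodes of the butterfly network: inputs `i₁`, `i₂`, outputs `o₁`, `o₂`, repeaters `n₁`,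
`n₂`. -/
inductive ButterflyNode
  | i₁ | i₂ | n₁ | n₂ | o₁ | o₂
  deriving DecidableEq

instance : Fintype ButterflyNode where
  elems := {.i₁, .i₂, .n₁, .n₂, .o₁, .o₂}
  complete v := by cases v <;> decide

/-- The butterfly network, with its seven edges `i₁o₁`, `i₁n₁`, `i₂o₂`, `i₂n₁`, `n₁n₂`, `n₂o₁`,
`n₂o₂`. -/
def butterfly : Network ButterflyNode (Fin 7) 2 where
  ends :=
    ![![.i₁, .o₁], ![.i₁, .n₁], ![.i₂, .o₂], ![.i₂, .n₁], ![.n₁, .n₂], ![.n₂, .o₁], ![.n₂, .o₂]]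
  input := ![.i₁, .i₂]
  output := ![.o₁, .o₂]

end QuantumNetwork

end

namespace QuantumNetwork

/-! The proof combines the canonical (Cartan) decomposition of two-qubit unitaries with a network
protocol for its nonlocal factor.

Up to unitaries on the single qubits, every two-qubit unitary is diagonal in the Bell basis
(`exists_tensorOp_mul_bellDiagonal_mul_tensorOp`). A unitary matrix is a product of real orthogonal,
diagonal and real orthogonal factors. In the magic basis a real orthogonal matrix is an isometry of
the quaternions, hence of the form `x ↦ p * x * r` or `x ↦ p * star x * r`. Left and right
multiplication act on the two qubits separately, and conjugation only changes signs of basis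
vectors, which the diagonal factor absorbs.

A Bell-diagonal operator is a phase depending only on the `Z`-parity and the `X`-parity of the two
qubits, so it suffices to bring these two bits coherently to `n₂`. After the local factor `B`, each
input node shares its computational bit with its output node and with `n₁`; `n₁` forwards only the
parity `a + b`. Each output node passes to an `X`-basis label, `p` or `q`, and shares it with `n₂`,
which thus has access to `p + q` too. There the phase `D (a + b) (p + q)` is applied and the
registers are erased by `X`-measurements. All random outcomes cause shifts and signs that are
corrected at `n₂` or at the outputs, where the local factor `A` is applied last.

Each branch has amplitude `±1/128`, independent of the input state, and there are `2 ^ 14` branches.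
Hence the channel is exactly conjugation by the unitary (`sum_butterfly_amplitude`,
`deterministicallyImplementable_of_three_rounds`). -/

/-! ### Factorisation of unitary matrices through real orthogonal ones -/

theorem exists_orthogonal_diagonal_of_commute {n : ℕ} {P Q : Matrix (Fin n) (Fin n) ℝ}
    (hP : P.IsSymm) (hQ : Q.IsSymm) (hPQ : Commute P Q) :
    ∃ O ∈ Matrix.orthogonalGroup (Fin n) ℝ, ∃ p q : Fin n → ℝ,
      P * O = O * Matrix.diagonal p ∧ Q * O = O * Matrix.diagonal q := by
  classical
  have hA : (Matrix.toEuclideanLin P).IsSymmetric :=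
    Matrix.isSymmetric_toEuclideanLin_iff.2 (by simpa [Matrix.IsHermitian] using hP.eq)
  have hB : (Matrix.toEuclideanLin Q).IsSymmetric :=
    Matrix.isSymmetric_toEuclideanLin_iff.2 (by simpa [Matrix.IsHermitian] using hQ.eq)
  have hAB : Commute (Matrix.toEuclideanLin P) (Matrix.toEuclideanLin Q) := by
    refine LinearMap.ext fun v => ?_
    have := congrArg (fun M => M *ᵥ v.ofLp) hPQ.eq
    simpa [Matrix.toLpLin_apply, Matrix.mulVec_mulVec] using this
  have hI := hA.directSum_isInternal_of_commute hB hAB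
  have hF := hA.orthogonalFamily_eigenspace_inf_eigenspace hB
  -- The joint eigenspaces are indexed by all of `ℝ × ℝ`; only finitely many are nonzero, and an
  -- adapted orthonormal basis needs a finite index.
  have := hF.independent.fintypeNeBotOfFiniteDimensional
  rw [← DirectSum.isInternal_ne_bot_iff] at hI
  have hF' := hF.comp (γ := {i : ℝ × ℝ // Module.End.eigenspace (Matrix.toEuclideanLin P) i.2 ⊓
    Module.End.eigenspace (Matrix.toEuclideanLin Q) i.1 ≠ ⊥}) Subtype.val_injective
  have hn : Module.finrank ℝ (EuclideanSpace ℝ (Fin n)) = n := by simp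
  let b := hI.subordinateOrthonormalBasis hn hF'
  let γ := fun a => (hI.subordinateOrthonormalBasisIndex hn a hF').1
  have hb (a : Fin n) := hI.subordinateOrthonormalBasis_subordinate hn a hF'
  refine ⟨Matrix.of fun i a => b a i, ?_, fun a => (γ a).2, fun a => (γ a).1, ?_, ?_⟩
  · rw [Matrix.mem_orthogonalGroup_iff']
    ext a a'
    have := b.orthonormal
    rw [orthonormal_iff_ite] at this
    rw [Matrix.one_apply, ← this a a', PiLp.inner_apply, Matrix.mul_apply]
    exact Finset.sum_congr rfl fun i _ => mul_comm _ _
  · ext i a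
    have := congrArg (fun v => v.ofLp i) (Module.End.mem_eigenspace_iff.1 (hb a).1)
    simp only [Matrix.toLpLin_apply, PiLp.smul_apply, smul_eq_mul] at this
    rw [Matrix.mul_diagonal]
    exact this.trans (mul_comm _ _)
  · ext i a
    have := congrArg (fun v => v.ofLp i) (Module.End.mem_eigenspace_iff.1 (hb a).2)
    simp only [Matrix.toLpLin_apply, PiLp.smul_apply, smul_eq_mul] at this
    rw [Matrix.mul_diagonal]
    exact this.trans (mul_comm _ _)

/-- The conjugate transpose and the transpose are both the inverse, so they agree and all entries
are real. -/
theorem exists_orthogonal_map_of_mem_unitaryGroup {n : ℕ} {V : Matrix (Fin n) (Fin n) ℂ}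
    (hV : Vᴴ * V = 1) (hV' : Vᵀ * V = 1) :
    ∃ O ∈ Matrix.orthogonalGroup (Fin n) ℝ, V = O.map Complex.ofReal := by
  have h : Vᴴ = Vᵀ := by
    have h1 := mul_eq_one_comm.1 hV
    calc Vᴴ = Vᵀ * V * Vᴴ := by rw [hV', one_mul]
      _ = Vᵀ := by rw [mul_assoc, h1, mul_one]
  have hre : V = (V.map Complex.re).map Complex.ofReal := by
    ext i j
    have := congrFun (congrFun h j) i
    simp only [Matrix.conjTranspose_apply, Matrix.transpose_apply] at this
    simpa using (Complex.conj_eq_iff_re.1 this).symm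
  refine ⟨V.map Complex.re, ?_, hre⟩
  rw [Matrix.mem_orthogonalGroup_iff']
  apply Matrix.map_injective Complex.ofReal_injective
  change ((V.map Complex.re)ᵀ * V.map Complex.re).map Complex.ofRealHom = _
  rw [Matrix.map_mul]
  change ((V.map Complex.re).map Complex.ofReal)ᵀ * ((V.map Complex.re).map Complex.ofReal) = _
  rw [← hre, hV']
  simp

/-- The symmetric unitary `S = Uᵀ * U` has a real orthonormal eigenbasis `W`. With `D` a square root
of its eigenvalues, `U * W * D⁻¹` is unitary and complex orthogonal, hence real. -/
theorem exists_orthogonal_mul_diagonal_mul_orthogonal {n : ℕ} {U : Matrix (Fin n) (Fin n) ℂ}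
    (hU : U ∈ Matrix.unitaryGroup (Fin n) ℂ) :
    ∃ O₁ ∈ Matrix.orthogonalGroup (Fin n) ℝ, ∃ O₂ ∈ Matrix.orthogonalGroup (Fin n) ℝ,
      ∃ D : Fin n → ℂ, (∀ i, ‖D i‖ = 1) ∧
        U = O₁.map Complex.ofReal * Matrix.diagonal D * (O₂.map Complex.ofReal)ᵀ := by
  have hU1 : Uᴴ * U = 1 := Matrix.mem_unitaryGroup_iff'.1 hU
  have hU2 : U * Uᴴ = 1 := Matrix.mem_unitaryGroup_iff.1 hU
  set S := Uᵀ * U with hS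
  have hSt : Sᵀ = S := by simp [hS]
  have hUc : U.map star * Uᵀ = 1 := by
    have := congrArg Matrix.transpose hU2
    rwa [Matrix.transpose_mul, Matrix.transpose_one] at this
  have hSS : Sᴴ * S = 1 := by
    calc Sᴴ * S = Uᴴ * (U.map star * Uᵀ) * U := by
          rw [hS, Matrix.conjTranspose_mul]; simp only [mul_assoc]; rfl
      _ = 1 := by rw [hUc, mul_one, hU1]
  have hSc : Sᴴ = S.map star := by
    conv_lhs => rw [← hSt]
    rfl
  have hSS' : S * Sᴴ = 1 := mul_eq_one_comm.1 hSS
  -- By symmetry `Sᴴ` is the entrywise conjugate of `S`, so the imaginary part of `Sᴴ * S = S * Sᴴ`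
  -- is the commutation relation.
  have hcomm : Commute (S.map Complex.re) (S.map Complex.im) := by
    ext i j
    have h1 := congrArg Complex.im (congrFun (congrFun (hSS.trans hSS'.symm) i) j)
    rw [hSc] at h1
    simp only [Matrix.mul_apply, Matrix.map_apply, Complex.im_sum, RCLike.star_def, Complex.mul_im,
      Complex.conj_re, Complex.conj_im, Finset.sum_add_distrib] at h1 ⊢
    simp only [neg_mul, mul_neg, Finset.sum_neg_distrib] at h1
    linarith
  have hP : (S.map Complex.re).IsSymm := by
    rw [Matrix.IsSymm, ← Matrix.transpose_map, hSt]
  have hQ : (S.map Complex.im).IsSymm := by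
    rw [Matrix.IsSymm, ← Matrix.transpose_map, hSt]
  obtain ⟨O, hO, p, q, hp, hq⟩ := exists_orthogonal_diagonal_of_commute hP hQ hcomm
  set W := O.map Complex.ofReal with hW
  have hWt : Wᴴ = Wᵀ := by
    ext i j
    simp [hW]
  have hWW : Wᵀ * W = 1 := by
    have := congrArg (fun M : Matrix (Fin n) (Fin n) ℝ => M.map Complex.ofRealHom)
      ((Matrix.mem_orthogonalGroup_iff' _ _).1 hO)
    simp only [Matrix.map_mul] at this
    refine Eq.trans ?_ (this.trans ?_)
    · rfl
    · simp
  have hSW : S * W = W * Matrix.diagonal (fun i => (p i + q i * Complex.I : ℂ)) := by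
    ext i j
    have h1 := congrFun (congrFun hp i) j
    have h2 := congrFun (congrFun hq i) j
    rw [Matrix.mul_diagonal, Matrix.mul_apply] at h1 h2 ⊢
    simp only [Matrix.map_apply] at h1 h2
    have h3 : ∀ k, S i k * W k j
        = ((S i k).re * O k j : ℝ) + ((S i k).im * O k j : ℝ) * Complex.I := by
      intro k
      conv_lhs => rw [← Complex.re_add_im (S i k)]
      simp only [hW, Matrix.map_apply]
      push_cast
      ring
    simp only [h3, Finset.sum_add_distrib, ← Finset.sum_mul, ← Complex.ofReal_sum, h1, h2]
    simp only [hW, Matrix.map_apply]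
    push_cast
    ring
  set z : Fin n → ℂ := fun i => (p i + q i * Complex.I : ℂ) with hz
  have hzd : Matrix.diagonal z = Wᵀ * S * W := by
    rw [mul_assoc, hSW, ← mul_assoc, hWW, one_mul]
  have hWW' : W * Wᵀ = 1 := mul_eq_one_comm.1 hWW
  have hz1 : ∀ i, star (z i) * z i = 1 := by
    have : (Matrix.diagonal z)ᴴ * Matrix.diagonal z = 1 := by
      rw [hzd]
      simp only [Matrix.conjTranspose_mul]
      have : (Wᵀ)ᴴ = W := by rw [← hWt, Matrix.conjTranspose_conjTranspose]
      rw [hWt, this]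
      calc _ = Wᵀ * (Sᴴ * ((W * Wᵀ) * S)) * W := by simp only [mul_assoc]
        _ = 1 := by rw [hWW', one_mul, hSS, mul_one, hWW]
    intro i
    have := congrFun (congrFun this i) i
    simpa [Matrix.diagonal_conjTranspose, Matrix.diagonal_mul_diagonal] using this
  choose D hD using fun i => IsAlgClosed.exists_pow_nat_eq (z i) (n := 2) (by norm_num)
  have hDn : ∀ i, ‖D i‖ = 1 := by
    intro i
    have h1 := congrArg norm (hz1 i)
    rw [norm_mul, norm_star, ← hD, norm_pow, norm_one] at h1
    have h2 : (‖D i‖ ^ 4 : ℝ) = 1 := by rw [← h1]; ring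
    exact (pow_eq_one_iff_of_nonneg (norm_nonneg _) (by norm_num)).1 h2
  have hD0 : ∀ i, D i ≠ 0 := fun i h => by simpa [h] using hDn i
  have hDs : ∀ i, star (D i) = (D i)⁻¹ := fun i => (Complex.inv_eq_conj (hDn i)).symm
  set E := Matrix.diagonal (fun i => (D i)⁻¹) with hE
  have hED : E * Matrix.diagonal D = 1 := by
    simp [hE, hD0]
  have hEE : Eᴴ * E = 1 := by
    simp [hE, Matrix.diagonal_conjTranspose, hDs, hD0]
  have hEz : E * Matrix.diagonal z * E = 1 := by
    rw [hE, Matrix.diagonal_mul_diagonal, Matrix.diagonal_mul_diagonal, ← Matrix.diagonal_one]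
    congr 1
    ext i
    rw [← hD i]
    field_simp [hD0 i]
  have hVV : (U * W * E)ᴴ * (U * W * E) = 1 := by
    simp only [Matrix.conjTranspose_mul]
    calc _ = Eᴴ * (Wᴴ * (Uᴴ * U) * W) * E := by simp only [mul_assoc]
      _ = 1 := by rw [hU1, mul_one, hWt, hWW, mul_one, hEE]
  have hVt : (U * W * E)ᵀ * (U * W * E) = 1 := by
    simp only [Matrix.transpose_mul]
    calc _ = Eᵀ * (Wᵀ * S * W) * E := by simp only [mul_assoc, hS]
      _ = 1 := by rw [← hzd, hE, Matrix.diagonal_transpose, ← hE, hEz]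
  obtain ⟨O₁, hO₁, h⟩ := exists_orthogonal_map_of_mem_unitaryGroup hVV hVt
  refine ⟨O₁, hO₁, O, hO, D, hDn, ?_⟩
  rw [← h, mul_assoc (U * W), hED, mul_one, ← hW, mul_assoc, hWW', mul_one]

/-! ### Linear isometries of the quaternions -/

open scoped Quaternion

/-- An isometry is a product of hyperplane reflections, and the reflection orthogonal to a unit
quaternion `u` is `x ↦ -u * star x * u`. Each reflection therefore switches between the two forms.
-/
theorem exists_mul_mul_of_linearIsometryEquiv (f : ℍ ≃ₗᵢ[ℝ] ℍ) :
    ∃ p ∈ unitary ℍ, ∃ r ∈ unitary ℍ, (∀ x, f x = p * x * r) ∨ ∀ x, f x = p * star x * r := by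
  have key : ∀ l : List ℍ, ∃ p ∈ unitary ℍ, ∃ r ∈ unitary ℍ,
      (∀ x, (l.map fun v => (ℝ ∙ v)ᗮ.reflection).prod x = p * x * r) ∨
        ∀ x, (l.map fun v => (ℝ ∙ v)ᗮ.reflection).prod x = p * star x * r := by
    intro l
    induction l with
    | nil => exact ⟨1, one_mem _, 1, one_mem _, Or.inl fun x => by simp⟩
    | cons v l ih =>
      obtain ⟨p, hp, r, hr, h⟩ := ih
      -- The list of vectors may contain zero, whose "reflection" is the identity.
      by_cases hv : v = 0
      · refine ⟨p, hp, r, hr, ?_⟩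
        have h0 : (ℝ ∙ v)ᗮ.reflection = 1 := by
          ext1 x
          have : (⊤ : Submodule ℝ ℍ).starProjection x = x :=
            Submodule.starProjection_eq_self_iff.2 trivial
          simp [hv, Submodule.reflection_apply, this, two_mul]
        simpa [h0] using h
      · set u : ℍ := ‖v‖⁻¹ • v with hu
        have hv' : ‖v‖ ≠ 0 := norm_ne_zero_iff.2 hv
        have hspan : (ℝ ∙ v) = ℝ ∙ u := by
          rw [hu, Submodule.span_singleton_smul_eq (IsUnit.mk0 _ (inv_ne_zero hv'))]
        have hun : ‖u‖ = 1 := by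
          rw [hu, norm_smul, norm_inv, norm_norm, inv_mul_cancel₀ hv']
        have hns : Quaternion.normSq u = 1 := by
          rw [Quaternion.normSq_eq_norm_mul_self, hun, one_mul]
        have huu : u ∈ unitary ℍ := by
          rw [Unitary.mem_iff, Quaternion.star_mul_self, Quaternion.self_mul_star, hns]
          simp
        have hrefl : ∀ x, (ℝ ∙ v)ᗮ.reflection x = (-u) * star x * u := by
          intro x
          simp only [hspan]
          rw [Submodule.reflection_orthogonal_apply, Submodule.reflection_singleton_apply, hun]
          have h1 : u * star x + x * star u = ((2 * inner ℝ u x : ℝ) : ℍ) := by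
            have := Quaternion.self_add_star (u * star x)
            rw [star_mul, star_star] at this
            rw [this, Quaternion.inner_def, Quaternion.coe_mul]
            rfl
          have h2 : star u * u = 1 := (Unitary.mem_iff.1 huu).1
          have h3 : u * star x * u = (2 * inner ℝ u x) • u - x := by
            rw [← Quaternion.coe_mul_eq_smul, ← h1, add_mul, mul_assoc x, h2, mul_one,
              add_sub_cancel_right]
          rw [neg_mul, neg_mul, h3]
          simp only [RCLike.ofReal_one, one_pow, div_one, two_smul, ← add_smul]
          ring_nf
        have hneg : ∀ y ∈ unitary ℍ, -y ∈ unitary ℍ := fun y hy => by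
          rw [Unitary.mem_iff] at hy ⊢
          simpa using hy
        rcases h with h | h
        · refine ⟨-u * star r, mul_mem (hneg _ huu) (Unitary.star_mem hr), star p * u,
            mul_mem (Unitary.star_mem hp) huu, Or.inr fun x => ?_⟩
          rw [List.map_cons, List.prod_cons, LinearIsometryEquiv.coe_mul, Function.comp_apply, h,
            hrefl]
          simp only [star_mul, mul_assoc]
        · refine ⟨-u * star r, mul_mem (hneg _ huu) (Unitary.star_mem hr), star p * u,
            mul_mem (Unitary.star_mem hp) huu, Or.inl fun x => ?_⟩
          rw [List.map_cons, List.prod_cons, LinearIsometryEquiv.coe_mul, Function.comp_apply, h,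
            hrefl]
          simp only [star_mul, star_star, mul_assoc]
  obtain ⟨l, -, hl⟩ := f.reflections_generate_dim
  obtain ⟨p, hp, r, hr, h⟩ := key l
  rw [← hl] at h
  exact ⟨p, hp, r, hr, h⟩

/-- The representation of quaternions by complex `2 × 2` matrices. -/
def quaternionMatrix (x : ℍ) : Matrix (Fin 2) (Fin 2) ℂ :=
  !![⟨x.re, x.imI⟩, ⟨x.imJ, x.imK⟩; ⟨-x.imJ, x.imK⟩, ⟨x.re, -x.imI⟩]

theorem quaternionMatrix_mul (x y : ℍ) :
    quaternionMatrix (x * y) = quaternionMatrix x * quaternionMatrix y := by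
  ext i j
  fin_cases i <;> fin_cases j <;>
    simp [quaternionMatrix, Matrix.mul_apply, Fin.sum_univ_two, Complex.ext_iff] <;>
    constructor <;> ring

theorem quaternionMatrix_neg (x : ℍ) : quaternionMatrix (-x) = -quaternionMatrix x := by
  ext i j
  fin_cases i <;> fin_cases j <;> simp [quaternionMatrix, Complex.ext_iff]

theorem quaternionMatrix_one : quaternionMatrix 1 = 1 := by
  ext i j
  fin_cases i <;> fin_cases j <;> simp [quaternionMatrix, Complex.ext_iff]

theorem quaternionMatrix_star (x : ℍ) : quaternionMatrix (star x) = (quaternionMatrix x)ᴴ := by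
  ext i j
  fin_cases i <;> fin_cases j <;> simp [quaternionMatrix, Complex.ext_iff]

theorem quaternionMatrix_mem_unitaryGroup {x : ℍ} (hx : x ∈ unitary ℍ) :
    quaternionMatrix x ∈ Matrix.unitaryGroup (Fin 2) ℂ := by
  rw [Matrix.mem_unitaryGroup_iff, Matrix.star_eq_conjTranspose, ← quaternionMatrix_star,
    ← quaternionMatrix_mul, (Unitary.mem_iff.1 hx).2, quaternionMatrix_one]

/-! ### The magic basis and local unitaries -/

/-- The quaternions `1, i, j, k`. -/
noncomputable def quaternionUnit (k : Fin 4) : ℍ :=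
  Quaternion.linearIsometryEquivTuple.symm (EuclideanSpace.single k 1)

/-- The columns are the vectors of the magic basis of two qubits. -/
noncomputable def magicBasis : Matrix (Fin 2 → Fin 2) (Fin 4) ℂ :=
  Matrix.of fun x k => (1 / (Real.sqrt 2 : ℂ)) * quaternionMatrix (quaternionUnit k) (x 0) (x 1)

theorem tensorOp_mul {V : Type} [Fintype V] [DecidableEq V] {d d' d'' : V → Type}
    [∀ v, Fintype (d' v)]
    (A : ∀ v, Matrix (d'' v) (d' v) ℂ) (B : ∀ v, Matrix (d' v) (d v) ℂ) :
    tensorOp A * tensorOp B = tensorOp fun v => A v * B v := by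
  ext x y
  simp only [tensorOp, Matrix.mul_apply, Matrix.of_apply, Finset.prod_univ_sum,
    Fintype.piFinset_univ, Finset.prod_mul_distrib]

theorem tensorOp_conjTranspose {V : Type} [Fintype V] {d d' : V → Type}
    (A : ∀ v, Matrix (d' v) (d v) ℂ) : (tensorOp A)ᴴ = tensorOp fun v => (A v)ᴴ := by
  ext x y
  simp [tensorOp]

theorem sum_two_bits {M : Type*} [AddCommMonoid M] (f : (Fin 2 → Fin 2) → M) :
    ∑ x, f x = ∑ a, ∑ b, f ![a, b] := by
  rw [← (finTwoArrowEquiv (Fin 2)).symm.sum_comp, Fintype.sum_prod_type]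
  rfl

theorem magicBasis_conjTranspose_mul : magicBasisᴴ * magicBasis = 1 := by
  have h2 : ((Real.sqrt 2 : ℝ) : ℂ)⁻¹ * ((Real.sqrt 2 : ℝ) : ℂ)⁻¹ = 1 / 2 := by
    rw [← mul_inv, ← Complex.ofReal_mul, Real.mul_self_sqrt zero_le_two]; simp
  have hm (x y : Fin 2 → Fin 2) (k l : Fin 4) : star (magicBasis x k) * magicBasis y l =
      (1 / 2) * (star (quaternionMatrix (quaternionUnit k) (x 0) (x 1)) *
        quaternionMatrix (quaternionUnit l) (y 0) (y 1)) := by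
    rw [← h2]
    simp [magicBasis]
    ring
  ext k l
  rw [Matrix.mul_apply, sum_two_bits]
  simp only [Matrix.conjTranspose_apply, hm]
  fin_cases k <;> fin_cases l <;>
    simp [quaternionUnit, quaternionMatrix, Fin.sum_univ_two, Complex.ext_iff] <;> norm_num

theorem magicBasis_mulVec (a : Fin 4 → ℝ) (x : Fin 2 → Fin 2) :
    (magicBasis *ᵥ fun k => (a k : ℂ)) x = (1 / (Real.sqrt 2 : ℂ)) *
      quaternionMatrix (Quaternion.linearIsometryEquivTuple.symm (WithLp.toLp 2 a)) (x 0) (x 1) := by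
  simp only [Matrix.mulVec, dotProduct, magicBasis, Matrix.of_apply, mul_assoc, ← Finset.mul_sum]
  congr 1
  generalize x 0 = i
  generalize x 1 = j
  rw [Fin.sum_univ_four]
  fin_cases i <;> fin_cases j <;>
    simp [quaternionUnit, quaternionMatrix, Complex.ext_iff]

/-- Real combinations of the magic basis vectors are quaternions read as `2 × 2` matrices. The
diagonal phases `c` are needed only for orientation-reversing isometries. -/
theorem magicBasis_mul_orthogonal {O : Matrix (Fin 4) (Fin 4) ℝ}
    (hO : O ∈ Matrix.orthogonalGroup (Fin 4) ℝ) :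
    ∃ A : Fin 2 → Matrix (Fin 2) (Fin 2) ℂ, (∀ i, A i ∈ Matrix.unitaryGroup (Fin 2) ℂ) ∧
      ∃ c : Fin 4 → ℂ, (∀ k, ‖c k‖ = 1) ∧
        magicBasis * O.map Complex.ofReal = tensorOp A * magicBasis * Matrix.diagonal c := by
  let e := Quaternion.linearIsometryEquivTuple
  let g : EuclideanSpace ℝ (Fin 4) ≃ₗᵢ[ℝ] EuclideanSpace ℝ (Fin 4) :=
    Unitary.linearIsometryEquiv ⟨Matrix.toEuclideanCLM (𝕜 := ℝ) O, Unitary.map_mem _ hO⟩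
  have hg (k : Fin 4) : g (EuclideanSpace.single k 1) = WithLp.toLp 2 (O.col k) := by
    change Matrix.toEuclideanCLM (𝕜 := ℝ) O _ = _
    ext i
    simp
  obtain ⟨p, hp, r, hr, h⟩ := exists_mul_mul_of_linearIsometryEquiv ((e.trans g).trans e.symm)
  have hcol (x : Fin 2 → Fin 2) (k : Fin 4) : (magicBasis * O.map Complex.ofReal) x k =
      (1 / (Real.sqrt 2 : ℂ)) *
        quaternionMatrix (((e.trans g).trans e.symm) (quaternionUnit k)) (x 0) (x 1) := by
    refine (magicBasis_mulVec (O.col k) x).trans ?_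
    rw [← hg]
    change _ = _ * quaternionMatrix (e.symm (g (e (e.symm _)))) _ _
    rw [e.apply_symm_apply]
  -- A matrix product `P * X * R` is `P ⊗ Rᵀ` applied to the entries of `X`, which explains the
  -- transpose.
  have htens (x : Fin 2 → Fin 2) (k : Fin 4) :
      (tensorOp ![quaternionMatrix p, (quaternionMatrix r)ᵀ] * magicBasis) x k =
        (1 / (Real.sqrt 2 : ℂ)) * quaternionMatrix (p * quaternionUnit k * r) (x 0) (x 1) := by
    rw [Matrix.mul_apply, sum_two_bits, quaternionMatrix_mul, quaternionMatrix_mul]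
    simp [tensorOp, magicBasis, Matrix.mul_apply, Fin.sum_univ_two]
    ring
  have hA : ∀ i, (![quaternionMatrix p, (quaternionMatrix r)ᵀ] : Fin 2 → _) i ∈
      Matrix.unitaryGroup (Fin 2) ℂ := by
    intro i
    fin_cases i
    · exact quaternionMatrix_mem_unitaryGroup hp
    · rw [Matrix.mem_unitaryGroup_iff]
      have := congrArg Matrix.transpose
        (Matrix.mem_unitaryGroup_iff'.1 (quaternionMatrix_mem_unitaryGroup hr))
      rwa [Matrix.transpose_mul, Matrix.transpose_one] at this
  rcases h with h | h
  · refine ⟨_, hA, fun _ => 1, by simp, ?_⟩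
    ext x k
    rw [hcol, h, Matrix.mul_diagonal, htens, mul_one]
  -- Conjugation fixes the quaternion `1` and negates `i, j, k`.
  · refine ⟨_, hA, ![1, -1, -1, -1], fun k => by fin_cases k <;> simp, ?_⟩
    ext x k
    rw [hcol, h, Matrix.mul_diagonal, htens]
    obtain ⟨h1, h2⟩ | ⟨h1, h2⟩ : star (quaternionUnit k) = quaternionUnit k ∧
        (![1, -1, -1, -1] : Fin 4 → ℂ) k = 1 ∨ star (quaternionUnit k) = -quaternionUnit k ∧
          (![1, -1, -1, -1] : Fin 4 → ℂ) k = -1 := by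
      fin_cases k
      · refine Or.inl ⟨?_, rfl⟩
        apply Quaternion.ext <;>
          simp only [Quaternion.re_star, Quaternion.imI_star, Quaternion.imJ_star,
            Quaternion.imK_star] <;>
          simp [quaternionUnit]
      all_goals
        refine Or.inr ⟨?_, rfl⟩
        apply Quaternion.ext <;>
          simp only [Quaternion.re_star, Quaternion.imI_star, Quaternion.imJ_star,
            Quaternion.imK_star, Quaternion.re_neg, Quaternion.imI_neg, Quaternion.imJ_neg,
            Quaternion.imK_neg]
        all_goals simp [quaternionUnit]
    · rw [h1, h2, mul_one]
    · rw [h1, h2, mul_neg, neg_mul, quaternionMatrix_neg, Matrix.neg_apply]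
      ring

/-! ### Bell-diagonal operators and the canonical decomposition -/

/-- The sign character of the group `Fin 2`. -/
def bitSign (a : Fin 2) : ℂ := if a = 0 then 1 else -1

/-- The two-qubit operator that multiplies by `D p q` the Bell state with `Z`-parity `p` and
`X`-parity `q`. -/
noncomputable def bellDiagonal (D : Fin 2 → Fin 2 → ℂ) : Matrix (Fin 2 → Fin 2) (Fin 2 → Fin 2) ℂ :=
  Matrix.of fun y a => if y 0 + y 1 = a 0 + a 1 then
    (1 / 2) * ∑ q, D (a 0 + a 1) q * bitSign (q * (y 0 + a 0)) else 0

/-- Up to phases the units `1, i, j, k` are the Bell states of (`Z`, `X`)-parity `(0,0), (0,1),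
(1,1), (1,0)`; hence `D 3` precedes `D 2`. -/
theorem magicBasis_diagonal (D : Fin 4 → ℂ) :
    magicBasis * Matrix.diagonal D * magicBasisᴴ =
      bellDiagonal ![![D 0, D 1], ![D 3, D 2]] := by
  have h2 : ((Real.sqrt 2 : ℝ) : ℂ)⁻¹ * ((Real.sqrt 2 : ℝ) : ℂ)⁻¹ = 1 / 2 := by
    rw [← mul_inv, ← Complex.ofReal_mul, Real.mul_self_sqrt zero_le_two]; simp
  have hm (x y : Fin 2 → Fin 2) (k : Fin 4) :
      magicBasis x k * D k * star (magicBasis y k) =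
      (1 / 2) * (quaternionMatrix (quaternionUnit k) (x 0) (x 1) * D k *
        star (quaternionMatrix (quaternionUnit k) (y 0) (y 1))) := by
    rw [← h2]
    simp [magicBasis]
    ring
  ext y a
  rw [Matrix.mul_apply]
  simp only [Matrix.mul_diagonal, Matrix.conjTranspose_apply, hm, bellDiagonal, Matrix.of_apply]
  generalize y 0 = y₀
  generalize y 1 = y₁
  generalize a 0 = a₀
  generalize a 1 = a₁
  have hI : ∀ z : ℂ, (⟨0, 1⟩ : ℂ) * z * ⟨0, -1⟩ = z ∧ (⟨0, 1⟩ : ℂ) * z * ⟨0, 1⟩ = -z ∧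
      (⟨0, -1⟩ : ℂ) * z * ⟨0, -1⟩ = -z ∧ (⟨0, -1⟩ : ℂ) * z * ⟨0, 1⟩ = z := by
    intro z
    simp [Complex.ext_iff]
  have h1 : (⟨1, 0⟩ : ℂ) = 1 := rfl
  have hn1 : (⟨-1, 0⟩ : ℂ) = -1 := by simp [Complex.ext_iff]
  have h0 : (⟨0, 0⟩ : ℂ) = 0 := rfl
  have hc : ∀ a b : ℝ, (starRingEnd ℂ) ⟨a, b⟩ = ⟨a, -b⟩ := fun _ _ => rfl
  rw [Fin.sum_univ_four, Fin.sum_univ_two]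
  fin_cases y₀ <;> fin_cases y₁ <;> fin_cases a₀ <;> fin_cases a₁ <;>
    simp [quaternionUnit, quaternionMatrix, bitSign, hI, h1, hn1, h0, hc]
  all_goals ring

theorem exists_tensorOp_mul_bellDiagonal_mul_tensorOp
    {U : Matrix (Fin 2 → Fin 2) (Fin 2 → Fin 2) ℂ}
    (hU : U ∈ Matrix.unitaryGroup (Fin 2 → Fin 2) ℂ) :
    ∃ A B : Fin 2 → Matrix (Fin 2) (Fin 2) ℂ, ∃ D : Fin 2 → Fin 2 → ℂ,
      (∀ i, A i ∈ Matrix.unitaryGroup (Fin 2) ℂ) ∧ (∀ i, B i ∈ Matrix.unitaryGroup (Fin 2) ℂ) ∧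
      (∀ p q, ‖D p q‖ = 1) ∧ U = tensorOp A * bellDiagonal D * tensorOp B := by
  have hTT' : magicBasis * magicBasisᴴ = 1 :=
    (Matrix.mul_eq_one_comm_of_card_eq _ _ _ (by simp)).1 magicBasis_conjTranspose_mul
  have hU1 : Uᴴ * U = 1 := Matrix.mem_unitaryGroup_iff'.1 hU
  have hU' : magicBasisᴴ * U * magicBasis ∈ Matrix.unitaryGroup (Fin 4) ℂ := by
    rw [Matrix.mem_unitaryGroup_iff', Matrix.star_eq_conjTranspose]
    simp only [Matrix.conjTranspose_mul, Matrix.conjTranspose_conjTranspose]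
    calc _ = magicBasisᴴ * (Uᴴ * (magicBasis * magicBasisᴴ) * U) * magicBasis := by
          simp only [Matrix.mul_assoc]
      _ = 1 := by rw [hTT', mul_one, hU1, Matrix.mul_one, magicBasis_conjTranspose_mul]
  obtain ⟨O₁, hO₁, O₂, hO₂, D, hD, h⟩ := exists_orthogonal_mul_diagonal_mul_orthogonal hU'
  obtain ⟨A, hA, c₁, hc₁, h₁⟩ := magicBasis_mul_orthogonal hO₁
  obtain ⟨B, hB, c₂, hc₂, h₂⟩ := magicBasis_mul_orthogonal hO₂
  have hO₂t : (O₂.map Complex.ofReal)ᵀ = (O₂.map Complex.ofReal)ᴴ := by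
    ext i j
    simp
  have hUe : U = magicBasis * (magicBasisᴴ * U * magicBasis) * magicBasisᴴ := by
    calc U = (magicBasis * magicBasisᴴ) * U * (magicBasis * magicBasisᴴ) := by
          rw [hTT', one_mul, mul_one]
      _ = _ := by simp only [Matrix.mul_assoc]
  let D' : Fin 4 → ℂ := fun k => c₁ k * D k * star (c₂ k)
  have hD' : ∀ k, ‖D' k‖ = 1 := fun k => by simp [D', hc₁, hc₂, hD]
  refine ⟨A, fun i => (B i)ᴴ, ![![D' 0, D' 1], ![D' 3, D' 2]], hA, fun i => ?_, ?_, ?_⟩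
  · exact Unitary.star_mem (hB i)
  · intro p q
    fin_cases p <;> fin_cases q <;> exact hD' _
  · rw [← magicBasis_diagonal, ← tensorOp_conjTranspose, hUe, h, hO₂t]
    calc _ = (magicBasis * O₁.map Complex.ofReal) * Matrix.diagonal D *
          (magicBasis * O₂.map Complex.ofReal)ᴴ := by
          simp only [Matrix.conjTranspose_mul, Matrix.mul_assoc]
      _ = tensorOp A * (magicBasis * (Matrix.diagonal c₁ * Matrix.diagonal D *
          (Matrix.diagonal c₂)ᴴ) * magicBasisᴴ) * (tensorOp B)ᴴ := by
          rw [h₁, h₂]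
          simp only [Matrix.conjTranspose_mul, Matrix.mul_assoc]
      _ = _ := by
          rw [Matrix.diagonal_conjTranspose, Matrix.diagonal_mul_diagonal,
            Matrix.diagonal_mul_diagonal]
          rfl

/-! ### Three-round protocols on pure states -/

theorem mul_ketbra_mul_conjTranspose {m n : Type} [Fintype n] (M : Matrix m n ℂ) (φ : n → ℂ) :
    M * ketbra φ * Mᴴ = ketbra (M *ᵥ φ) := by
  rw [ketbra, ketbra, Matrix.mul_vecMulVec, Matrix.vecMulVec_mul, Matrix.star_mulVec]

theorem ketbra_smul {m : Type} (c : ℂ) (φ : m → ℂ) :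
    ketbra (c • φ) = (c * star c) • ketbra φ := by
  ext i j
  simp [ketbra, Matrix.vecMulVec_apply]
  ring

theorem distribute_ketbra {Q V : Type} (loc : Q → V) (φ : (Q → Fin 2) → ℂ) :
    distribute loc (ketbra φ) = ketbra (φ ∘ glue loc) := rfl

/-- The bit strings over all qubits are the tuples of local bit strings. -/
def glueEquiv {Q V : Type} (loc : Q → V) : (∀ v, LocalBasis loc v) ≃ (Q → Fin 2) where
  toFun := glue loc
  invFun z := fun _ q => z q.1
  left_inv x := by
    funext v ⟨q, hq⟩
    subst hq
    rfl
  right_inv _ := rfl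

/-- On a pure state every branch stays pure, so the channel is determined by one product of local
operators per branch. The last round consists of isometries and has a single outcome. -/
theorem isLOCC_three_rounds {V : Type} [Fintype V] [DecidableEq V]
    {d₀ d₁ d₂ d₃ Out₁ Out₂ : V → Type}
    [∀ v, Fintype (d₀ v)] [∀ v, DecidableEq (d₀ v)] [∀ v, Fintype (d₁ v)]
    [∀ v, DecidableEq (d₁ v)] [∀ v, Fintype (d₂ v)] [∀ v, DecidableEq (d₂ v)]
    [∀ v, Fintype (d₃ v)] [∀ v, Fintype (Out₁ v)] [∀ v, Fintype (Out₂ v)]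
    (K₁ : ∀ v, Out₁ v → Matrix (d₁ v) (d₀ v) ℂ)
    (K₂ : (∀ v, Out₁ v) → ∀ v, Out₂ v → Matrix (d₂ v) (d₁ v) ℂ)
    (K₃ : (∀ v, Out₁ v) → (∀ v, Out₂ v) → ∀ v, Matrix (d₃ v) (d₂ v) ℂ)
    (h₁ : ∀ v, ∑ j, (K₁ v j)ᴴ * K₁ v j = 1)
    (h₂ : ∀ j₁ v, ∑ j, (K₂ j₁ v j)ᴴ * K₂ j₁ v j = 1)
    (h₃ : ∀ j₁ j₂ v, (K₃ j₁ j₂ v)ᴴ * K₃ j₁ j₂ v = 1) :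
    ∃ Γ : GlobalOp d₀ → GlobalOp d₃, IsLOCC Γ ∧ ∀ φ, Γ (ketbra φ) =
      ∑ j₁, ∑ j₂, ketbra (tensorOp (fun v => K₃ j₁ j₂ v * K₂ j₁ v (j₂ v) * K₁ v (j₁ v)) *ᵥ φ) := by
  refine ⟨_, .round K₁ h₁ _ fun j₁ => .round (K₂ j₁) (h₂ j₁) _ fun j₂ =>
    .round (Out := fun _ => Unit) (fun v _ => K₃ j₁ j₂ v) (fun v => ?_) _ fun _ => .idle,
    fun φ => ?_⟩
  · simpa using h₃ j₁ j₂ v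
  · simp only [Fintype.sum_unique]
    refine Finset.sum_congr rfl fun j₁ _ => Finset.sum_congr rfl fun j₂ _ => ?_
    rw [mul_ketbra_mul_conjTranspose, mul_ketbra_mul_conjTranspose, mul_ketbra_mul_conjTranspose,
      Matrix.mulVec_mulVec, Matrix.mulVec_mulVec, tensorOp_mul, tensorOp_mul]

namespace Network

variable {V E : Type} {k : ℕ}

/-- The coefficients `c` do not depend on `ψ`: the outcomes carry no information about the input,
and the branches add up to the exact target state. -/
theorem deterministicallyImplementable_of_three_rounds [Fintype V] [DecidableEq V] [Fintype E]
    [DecidableEq E]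
    (N : Network V E k) (U : Matrix (Fin k → Fin 2) (Fin k → Fin 2) ℂ)
    {d₁ d₂ Out₁ Out₂ : V → Type}
    [∀ v, Fintype (d₁ v)] [∀ v, DecidableEq (d₁ v)] [∀ v, Fintype (d₂ v)]
    [∀ v, DecidableEq (d₂ v)] [∀ v, Fintype (Out₁ v)] [∀ v, Fintype (Out₂ v)]
    (K₁ : ∀ v, Out₁ v → Matrix (d₁ v) (LocalBasis N.startLoc v) ℂ)
    (K₂ : (∀ v, Out₁ v) → ∀ v, Out₂ v → Matrix (d₂ v) (d₁ v) ℂ)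
    (K₃ : (∀ v, Out₁ v) → (∀ v, Out₂ v) → ∀ v, Matrix (LocalBasis N.output v) (d₂ v) ℂ)
    (h₁ : ∀ v, ∑ j, (K₁ v j)ᴴ * K₁ v j = 1)
    (h₂ : ∀ j₁ v, ∑ j, (K₂ j₁ v j)ᴴ * K₂ j₁ v j = 1)
    (h₃ : ∀ j₁ j₂ v, (K₃ j₁ j₂ v)ᴴ * K₃ j₁ j₂ v = 1)
    (c : (∀ v, Out₁ v) → (∀ v, Out₂ v) → ℂ) (hc : ∑ j₁, ∑ j₂, c j₁ j₂ * star (c j₁ j₂) = 1)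
    (h : ∀ j₁ j₂ ψ, tensorOp (fun v => K₃ j₁ j₂ v * K₂ j₁ v (j₂ v) * K₁ v (j₁ v)) *ᵥ
      (startVec ψ ∘ glue N.startLoc) = c j₁ j₂ • ((U *ᵥ ψ) ∘ glue N.output)) :
    N.DeterministicallyImplementable U := by
  obtain ⟨Γ, hΓ, hΓ'⟩ := isLOCC_three_rounds K₁ K₂ K₃ h₁ h₂ h₃
  refine ⟨Γ, hΓ, fun ψ _ => ?_⟩
  rw [distribute_ketbra, hΓ', mul_ketbra_mul_conjTranspose, distribute_ketbra]
  simp only [h, ketbra_smul, ← Finset.sum_smul, hc, one_smul]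

/-- A Bell pair forces its two halves to carry the same bit, leaving one summation bit and one
factor `1/√2` per edge. -/
theorem sum_mul_startVec [Fintype E] [DecidableEq E] (F : ((E × Fin 2) ⊕ Fin k → Fin 2) → ℂ)
    (ψ : (Fin k → Fin 2) → ℂ) :
    ∑ z, F z * startVec ψ z = (1 / (Real.sqrt 2 : ℂ)) ^ Fintype.card E *
      ∑ b : E → Fin 2, ∑ i : Fin k → Fin 2, F (Sum.elim (fun q => b q.1) i) * ψ i := by
  rw [← (Equiv.sumArrowEquivProdArrow (E × Fin 2) (Fin k) (Fin 2)).symm.sum_comp,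
    Fintype.sum_prod_type]
  -- This separates the halves at the ends `0` and `1`; only the diagonal `b' = b` contributes.
  let f : (E → Fin 2) × (E → Fin 2) ≃ (E × Fin 2 → Fin 2) :=
    { toFun := fun p q => if q.2 = 0 then p.1 q.1 else p.2 q.1
      invFun := fun z => (fun e => z (e, 0), fun e => z (e, 1))
      left_inv := fun p => by simp
      right_inv := fun z => by
        funext ⟨e, s⟩
        fin_cases s <;> simp }
  rw [← f.sum_comp, Fintype.sum_prod_type, Finset.mul_sum]
  refine Finset.sum_congr rfl fun b _ => ?_
  rw [Finset.sum_eq_single b]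
  · rw [Finset.mul_sum]
    refine Finset.sum_congr rfl fun i _ => ?_
    have : f (b, b) = fun q => b q.1 := by
      funext q
      simp [f]
    rw [this]
    simp only [startVec, bell, Equiv.sumArrowEquivProdArrow, Equiv.coe_fn_symm_mk, Sum.elim_inl,
      Sum.elim_inr, if_true, Finset.prod_const, Finset.card_univ]
    ring
  · intro b' _ hb
    obtain ⟨e, he⟩ := Function.ne_iff.1 hb
    refine Finset.sum_eq_zero fun i _ => ?_
    have : ∏ e : E, bell (f (b, b') (e, 0)) (f (b, b') (e, 1)) = 0 := by
      refine Finset.prod_eq_zero (Finset.mem_univ e) ?_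
      simp [f, bell, Ne.symm he]
    simp only [startVec, Equiv.sumArrowEquivProdArrow, Equiv.coe_fn_symm_mk, Sum.elim_inl,
      Sum.elim_inr, this, zero_mul, mul_zero]
  · simp

theorem tensorOp_mulVec_startVec [Fintype V] [DecidableEq V] [Fintype E] [DecidableEq E]
    (N : Network V E k) {d : V → Type} (M : ∀ v, Matrix (d v) (LocalBasis N.startLoc v) ℂ)
    (ψ : (Fin k → Fin 2) → ℂ) (x : ∀ v, d v) :
    (tensorOp M *ᵥ (startVec ψ ∘ glue N.startLoc)) x = (1 / (Real.sqrt 2 : ℂ)) ^ Fintype.card E *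
      ∑ b : E → Fin 2, ∑ i : Fin k → Fin 2,
        (∏ v, M v (x v) fun q => Sum.elim (fun p : E × Fin 2 => b p.1) i q.1) * ψ i := by
  rw [← sum_mul_startVec (fun z => ∏ v, M v (x v) fun q => z q.1), Matrix.mulVec, dotProduct,
    ← (glueEquiv N.startLoc).symm.sum_comp]
  rfl

end Network

/-! ### Signs over the field with two elements, and the operators of the nodes -/

theorem bitSign_add (a b : Fin 2) : bitSign (a + b) = bitSign a * bitSign b := by
  fin_cases a <;> fin_cases b <;> simp [bitSign]

theorem bitSign_mul_self (a : Fin 2) : bitSign a * bitSign a = 1 := by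
  fin_cases a <;> simp [bitSign]

theorem star_bitSign (a : Fin 2) : star (bitSign a) = bitSign a := by
  fin_cases a <;> simp [bitSign]

theorem sum_bitSign_mul (a b : Fin 2) :
    ∑ w, bitSign (w * a) * bitSign (w * b) = if a = b then 2 else 0 := by
  rw [Fin.sum_univ_two]
  fin_cases a <;> fin_cases b <;> simp [bitSign] <;> norm_num

/-- The amplitude `1 / √2`. -/
noncomputable def invSqrtTwo : ℂ := 1 / (Real.sqrt 2 : ℂ)

theorem invSqrtTwo_mul_self : invSqrtTwo * invSqrtTwo = 1 / 2 := by
  rw [invSqrtTwo, div_mul_div_comm, ← Complex.ofReal_mul, Real.mul_self_sqrt zero_le_two]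
  simp

theorem star_invSqrtTwo : star invSqrtTwo = invSqrtTwo := by
  simp [invSqrtTwo]

theorem sum_one_bit {M : Type*} [AddCommMonoid M] (f : (Fin 1 → Fin 2) → M) :
    ∑ x, f x = ∑ a, f ![a] := by
  rw [← (Equiv.funUnique (Fin 1) (Fin 2)).symm.sum_comp]
  refine Finset.sum_congr rfl fun a _ => congrArg f ?_
  funext i
  fin_cases i
  rfl

theorem sum_bits_succ {n : ℕ} {M : Type*} [AddCommMonoid M] (f : (Fin (n + 1) → Fin 2) → M) :
    ∑ x, f x = ∑ a, ∑ y, f (Matrix.vecCons a y) := by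
  rw [← (Fin.consEquiv fun _ => Fin 2).sum_comp, Fintype.sum_prod_type]
  rfl

theorem sum_three_bits {M : Type*} [AddCommMonoid M] (f : (Fin 3 → Fin 2) → M) :
    ∑ x, f x = ∑ a, ∑ b, ∑ c, f ![a, b, c] := by
  simp only [sum_bits_succ, Fintype.sum_unique]
  rfl

theorem sum_seven_bits {M : Type*} [AddCommMonoid M] (f : (Fin 7 → Fin 2) → M) :
    ∑ x, f x = ∑ a, ∑ b, ∑ c, ∑ d, ∑ e, ∑ g, ∑ h, f ![a, b, c, d, e, g, h] := by
  simp only [sum_bits_succ, Fintype.sum_unique]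
  rfl

/-- An input node with input bit `z` and Bell halves `e₀`, `e₁` applies `B` to its input qubit and
measures in a GHZ basis. -/
noncomputable def inputMeasurement (B : Matrix (Fin 2) (Fin 2) ℂ) (j : Fin 3 → Fin 2) :
    Matrix (Fin 0 → Fin 2) (Fin 3 → Fin 2) ℂ :=
  Matrix.of fun _ x => invSqrtTwo * bitSign (j 2 * (x 1 + j 0)) * B (x 1 + j 0) (x 0) *
    if x 2 = x 1 + j 0 + j 1 then 1 else 0

/-- The first repeater projects on a fixed parity of its three qubits. -/
noncomputable def parityMeasurement (j : Fin 3 → Fin 2) :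
    Matrix (Fin 0 → Fin 2) (Fin 3 → Fin 2) ℂ :=
  Matrix.of fun _ x => (1 / 2) * bitSign (j 1 * x 0) * bitSign (j 2 * x 1) *
    if x 2 = x 0 + x 1 + j 0 then 1 else 0

/-- An output node moves its qubit `x 0` to the `X`-basis, and copies it to the Bell half `x 1`. -/
noncomputable def outputMeasurement (j : Fin 1 → Fin 2) :
    Matrix (Fin 1 → Fin 2) (Fin 2 → Fin 2) ℂ :=
  Matrix.of fun y x => invSqrtTwo * bitSign (y 0 * x 0) * if x 1 = y 0 + j 0 then 1 else 0

/-- The second repeater holds the two parities, applies the phases `D`, and measures in the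
`X`-basis. -/
noncomputable def phaseMeasurement (D : Fin 2 → Fin 2 → ℂ) (c c' : Fin 2) (j : Fin 3 → Fin 2) :
    Matrix (Fin 0 → Fin 2) (Fin 3 → Fin 2) ℂ :=
  Matrix.of fun _ x => invSqrtTwo ^ 3 * D (x 0 + c) (x 1 + x 2 + c') *
    bitSign (j 0 * x 0) * bitSign (j 1 * x 1) * bitSign (j 2 * x 2)

/-- An output node returns to the computational basis, corrects by Pauli operators and applies
`A`. -/
noncomputable def outputCorrection (A : Matrix (Fin 2) (Fin 2) ℂ) (g k l : Fin 2) :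
    Matrix (Fin 1 → Fin 2) (Fin 1 → Fin 2) ℂ :=
  Matrix.of fun x y => ∑ b, A (x 0) b *
    (invSqrtTwo * bitSign (g * b) * bitSign (b * (y 0 + k)) * bitSign (y 0 * l))

theorem three_bits_eta (x : Fin 3 → Fin 2) : x = ![x 0, x 1, x 2] := by
  funext i
  fin_cases i <;> rfl

theorem two_bits_eta (x : Fin 2 → Fin 2) : x = ![x 0, x 1] := by
  funext i
  fin_cases i <;> rfl

theorem sum_star_mul_of_mem_unitaryGroup {B : Matrix (Fin 2) (Fin 2) ℂ}
    (hB : B ∈ Matrix.unitaryGroup (Fin 2) ℂ) (z z' : Fin 2) :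
    star (B 0 z) * B 0 z' + star (B 1 z) * B 1 z' = if z = z' then 1 else 0 := by
  have := congrFun (congrFun (Matrix.mem_unitaryGroup_iff'.1 hB) z) z'
  simpa [Matrix.mul_apply, Fin.sum_univ_two, Matrix.one_apply] using this

/-- Summing over the sign outcome forces `a = a'`. The second shift outcome then forces `b = b'`,
and the sum over the first runs through a full column of `B`, where unitarity applies. -/
theorem inputMeasurement_complete {B : Matrix (Fin 2) (Fin 2) ℂ}
    (hB : B ∈ Matrix.unitaryGroup (Fin 2) ℂ) :
    ∑ j, (inputMeasurement B j)ᴴ * inputMeasurement B j = 1 := by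
  ext x y
  rw [three_bits_eta x, three_bits_eta y]
  generalize x 0 = z, x 1 = a, x 2 = b, y 0 = z', y 1 = a', y 2 = b'
  have h := sum_star_mul_of_mem_unitaryGroup hB z z'
  simp only [Matrix.sum_apply, Matrix.mul_apply, Fintype.sum_unique, Matrix.conjTranspose_apply,
    inputMeasurement, Matrix.of_apply, star_mul', star_bitSign, star_invSqrtTwo]
  rw [sum_three_bits]
  have hr (s t : Fin 2) : ∑ r, invSqrtTwo * bitSign (r * (a + s)) * star (B (a + s) z) *
      star (if b = a + s + t then 1 else 0 : ℂ) * (invSqrtTwo * bitSign (r * (a' + s)) *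
      B (a' + s) z' * if b' = a' + s + t then 1 else 0) =
      if a = a' ∧ b = b' ∧ b = a + s + t then star (B (a + s) z) * B (a + s) z' else 0 := by
    calc _ = ∑ r, invSqrtTwo * invSqrtTwo * (star (B (a + s) z) * B (a' + s) z' *
          ((if b = a + s + t then 1 else 0) * if b' = a' + s + t then 1 else 0)) *
          (bitSign (r * (a + s)) * bitSign (r * (a' + s))) := by
          refine Finset.sum_congr rfl fun r _ => ?_
          rw [apply_ite star, star_one, star_zero]
          ring
      _ = _ := by
          rw [← Finset.mul_sum, sum_bitSign_mul, invSqrtTwo_mul_self]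
          by_cases ha : a = a'
          · subst ha
            by_cases hb : b = a + s + t
            · by_cases hb' : b' = a + s + t
              · simp [hb, hb']
                ring
              · simp [hb, hb', Ne.symm hb']
            · simp [hb]
          · simp [ha]
  calc _ = ∑ s, ∑ t, _ := Finset.sum_congr rfl fun s _ => Finset.sum_congr rfl fun t _ => hr s t
    _ = _ := by
      rw [Matrix.one_apply]
      simp only [Fin.sum_univ_two]
      fin_cases a <;> fin_cases b <;> fin_cases a' <;> fin_cases b' <;>
        simp [← h, add_comm]

theorem parityMeasurement_complete :
    ∑ j, (parityMeasurement j)ᴴ * parityMeasurement j = 1 := by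
  ext x y
  rw [three_bits_eta x, three_bits_eta y]
  generalize x 0 = a, x 1 = b, x 2 = c, y 0 = a', y 1 = b', y 2 = c'
  simp only [Matrix.sum_apply, Matrix.mul_apply, Fintype.sum_unique, Matrix.conjTranspose_apply,
    parityMeasurement, Matrix.of_apply, star_mul', star_bitSign]
  rw [sum_three_bits]
  calc _ = ∑ u, (1 / 4) * ((if c = a + b + u then 1 else 0) * if c' = a' + b' + u then 1 else 0) *
        (∑ w, bitSign (w * a) * bitSign (w * a')) * ∑ w, bitSign (w * b) * bitSign (w * b') := by
        refine Finset.sum_congr rfl fun u _ => ?_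
        rw [mul_assoc, Finset.sum_mul_sum, Finset.mul_sum]
        refine Finset.sum_congr rfl fun w _ => ?_
        rw [Finset.mul_sum]
        refine Finset.sum_congr rfl fun w' _ => ?_
        by_cases h : c = a + b + u <;> by_cases h' : c' = a' + b' + u
        · simp [h, h']
          ring
        all_goals simp [h, h']
    _ = _ := by
      simp only [sum_bitSign_mul]
      rw [Fin.sum_univ_two, Matrix.one_apply]
      fin_cases a <;> fin_cases b <;> fin_cases c <;> fin_cases a' <;> fin_cases b' <;>
        fin_cases c' <;> simp <;> norm_num

theorem outputMeasurement_complete :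
    ∑ j, (outputMeasurement j)ᴴ * outputMeasurement j = 1 := by
  have h2 : invSqrtTwo ^ 2 = 1 / 2 := by rw [sq, invSqrtTwo_mul_self]
  ext x y
  rw [two_bits_eta x, two_bits_eta y]
  generalize x 0 = a, x 1 = b, y 0 = a', y 1 = b'
  simp only [Matrix.sum_apply, Matrix.mul_apply, Matrix.conjTranspose_apply,
    outputMeasurement, Matrix.of_apply, star_mul', star_bitSign, star_invSqrtTwo]
  rw [sum_one_bit]
  simp only [sum_one_bit, Fin.sum_univ_two]
  fin_cases a <;> fin_cases b <;> fin_cases a' <;> fin_cases b' <;>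
    simp [bitSign, invSqrtTwo_mul_self] <;> norm_num

theorem phaseMeasurement_complete {D : Fin 2 → Fin 2 → ℂ} (hD : ∀ p q, ‖D p q‖ = 1)
    (c c' : Fin 2) :
    ∑ j, (phaseMeasurement D c c' j)ᴴ * phaseMeasurement D c c' j = 1 := by
  have h2 : invSqrtTwo ^ 3 * invSqrtTwo ^ 3 = 1 / 8 := by
    rw [← mul_pow, invSqrtTwo_mul_self]
    norm_num
  ext x y
  rw [three_bits_eta x, three_bits_eta y]
  generalize x 0 = p, x 1 = a, x 2 = b, y 0 = p', y 1 = a', y 2 = b'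
  simp only [Matrix.sum_apply, Matrix.mul_apply, Fintype.sum_unique, Matrix.conjTranspose_apply,
    phaseMeasurement, Matrix.of_apply, star_mul', star_bitSign, star_pow, star_invSqrtTwo]
  rw [sum_three_bits]
  calc _ = (1 / 8) * (star (D (p + c) (a + b + c')) * D (p' + c) (a' + b' + c')) *
        ((∑ w, bitSign (w * p) * bitSign (w * p')) * ((∑ w, bitSign (w * a) * bitSign (w * a')) *
          ∑ w, bitSign (w * b) * bitSign (w * b'))) := by
        rw [Finset.sum_mul_sum, Finset.sum_mul_sum, Finset.mul_sum]
        refine Finset.sum_congr rfl fun g _ => ?_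
        rw [Finset.mul_sum]
        refine Finset.sum_congr rfl fun w _ => ?_
        rw [Finset.mul_sum, Finset.mul_sum]
        refine Finset.sum_congr rfl fun w' _ => ?_
        rw [← h2]
        simp only [Matrix.cons_val]
        ring
    _ = _ := by
      simp only [sum_bitSign_mul, Matrix.one_apply]
      by_cases hp : p = p'
      · by_cases ha : a = a'
        · by_cases hb : b = b'
          · subst hp ha hb
            have := hD (p + c) (a + b + c')
            have hn : star (D (p + c) (a + b + c')) * D (p + c) (a + b + c') = 1 := by
              rw [RCLike.star_def, Complex.conj_mul', this]
              simp
            rw [hn]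
            norm_num
          · simp [hb]
        · simp [ha]
      · simp [hp]

theorem outputCorrection_isometry {A : Matrix (Fin 2) (Fin 2) ℂ}
    (hA : A ∈ Matrix.unitaryGroup (Fin 2) ℂ) (g k l : Fin 2) :
    (outputCorrection A g k l)ᴴ * outputCorrection A g k l = 1 := by
  -- The correction is `A` after a Hadamard matrix with row and column signs; the shift by `k` only
  -- permutes columns.
  have hR : outputCorrection A g k l = Matrix.of (fun x y => A (x 0) (y 0)) *
      Matrix.of (fun x y => invSqrtTwo * bitSign (g * x 0) * bitSign (x 0 * (y 0 + k)) *
        bitSign (y 0 * l) : (Fin 1 → Fin 2) → (Fin 1 → Fin 2) → ℂ) := by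
    ext x y
    rw [Matrix.mul_apply, sum_one_bit]
    rfl
  have hAA : (Matrix.of (fun x y => A (x 0) (y 0) : (Fin 1 → Fin 2) → (Fin 1 → Fin 2) → ℂ))ᴴ *
      Matrix.of (fun x y => A (x 0) (y 0)) = 1 := by
    ext x y
    rw [Matrix.mul_apply, sum_one_bit, Fin.sum_univ_two]
    refine (sum_star_mul_of_mem_unitaryGroup hA (x 0) (y 0)).trans ?_
    simp [Matrix.one_apply, funext_iff]
  rw [hR, Matrix.conjTranspose_mul, Matrix.mul_assoc, ← Matrix.mul_assoc _ _ (Matrix.of _), hAA,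
    one_mul]
  ext x y
  simp only [Matrix.mul_apply, Matrix.conjTranspose_apply, Matrix.of_apply, star_mul',
    star_bitSign, star_invSqrtTwo]
  rw [sum_one_bit]
  calc _ = ∑ b, invSqrtTwo * invSqrtTwo * (bitSign (g * b) * bitSign (g * b)) *
        (bitSign (x 0 * l) * bitSign (y 0 * l)) *
          (bitSign (b * (x 0 + k)) * bitSign (b * (y 0 + k))) := by
        refine Finset.sum_congr rfl fun b _ => ?_
        simp only [Matrix.cons_val]
        ring
    _ = _ := by
      simp only [invSqrtTwo_mul_self, bitSign_mul_self, mul_one]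
      rw [← Finset.mul_sum, sum_bitSign_mul, Matrix.one_apply]
      by_cases h : x 0 = y 0
      · have : x = y := funext fun i => by fin_cases i; exact h
        subst this
        simp [bitSign_mul_self]
      · have : x ≠ y := fun hxy => h (congrFun hxy 0)
        simp [h, this]

/-! ### The amplitude of a branch -/

/-- With `p + q` fixed, the sum over `p` yields `2` times the constraint `y₀ + y₁ = a + b`; the
other `2` cancels the `1/2` in `bellDiagonal`. -/
theorem sum_bellPhase (D : Fin 2 → Fin 2 → ℂ) (y₀ y₁ a b : Fin 2) :
    ∑ p, ∑ q, D (a + b) (p + q) * (bitSign (p * (a + y₀)) * bitSign (q * (b + y₁))) =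
      4 * bellDiagonal D ![y₀, y₁] ![a, b] := by
  simp only [bellDiagonal, Matrix.of_apply, Fin.sum_univ_two]
  fin_cases y₀ <;> fin_cases y₁ <;> fin_cases a <;> fin_cases b <;> simp [bitSign] <;> ring

/-- Erasing the `Z`-parity at `n₂` leaves the sign of `g * (a + b)`. Since the operator preserves
this parity, signs of `g * y₀` and `g * y₁` at the outputs cancel it. -/
theorem bitSign_mul_bellDiagonal (D : Fin 2 → Fin 2 → ℂ) (g y₀ y₁ a b : Fin 2) :
    bitSign (g * (a + b + (y₀ + y₁))) * bellDiagonal D ![y₀, y₁] ![a, b] =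
      bellDiagonal D ![y₀, y₁] ![a, b] := by
  by_cases h : y₀ + y₁ = a + b
  · have : a + b + (a + b) = 0 := by
      generalize a + b = c
      fin_cases c <;> rfl
    rw [h, this]
    simp [bitSign]
  · simp [bellDiagonal, h]

theorem sum_add_right {M : Type*} [AddCommMonoid M] (f : Fin 2 → M) (s : Fin 2) :
    ∑ x, f x = ∑ x, f (x + s) :=
  (Equiv.sum_comp (Equiv.addRight s) f).symm

theorem add_add_cancel_right (a s : Fin 2) : a + s + s = a := by
  grind

theorem parity_identity (a b t t' u : Fin 2) :
    a + t + (b + t') + u + (t + t' + u) = a + b := by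
  grind

theorem shift_identity (p q k k' : Fin 2) : p + k + (q + k') + (k + k') = p + q := by
  grind

/-- The left side collects the sign exponents of one branch after the shift of the `X`-labels; on
the right only outcome terms, the parity sign and the Bell phase remain. -/
theorem phase_identity (a b p q s s' t t' u r r' w w' g h h' m m' y₀ y₁ : Fin 2) :
    r * a + r' * b + (w * (a + t) + w' * (b + t')) + (g * (a + t + (b + t') + u) +
      h * (p + (r + w + m)) + h' * (q + (r' + w' + m'))) +
      ((p + (r + w + m) + m) * (a + s) + (g * y₀ + y₀ * (p + (r + w + m) + m + (r + w)) +
        (p + (r + w + m) + m) * (s + h))) +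
      ((q + (r' + w' + m') + m') * (b + s') + (g * y₁ + y₁ * (q + (r' + w' + m') + m' + (r' + w')) +
        (q + (r' + w' + m') + m') * (s' + h'))) =
      w * t + w' * t' + g * (t + t' + u) + h * m + h' * m' + g * (a + b + (y₀ + y₁)) +
        (p * (a + y₀) + q * (b + y₁)) := by
  grind

theorem sum_butterfly_phases (D : Fin 2 → Fin 2 → ℂ)
    (a b s s' t t' u r r' w w' g h h' m m' y₀ y₁ : Fin 2) :
    ∑ x, ∑ x', bitSign (r * a) * bitSign (r' * b) * (bitSign (w * (a + t)) *
      bitSign (w' * (b + t'))) *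
      (D (a + t + (b + t') + u + (t + t' + u)) (x + x' + (r + w + m + (r' + w' + m'))) *
        bitSign (g * (a + t + (b + t') + u)) * bitSign (h * x) * bitSign (h' * x')) *
      (bitSign ((x + m) * (a + s)) * (bitSign (g * y₀) * bitSign (y₀ * (x + m + (r + w))) *
        bitSign ((x + m) * (s + h)))) *
      (bitSign ((x' + m') * (b + s')) * (bitSign (g * y₁) * bitSign (y₁ * (x' + m' + (r' + w'))) *
        bitSign ((x' + m') * (s' + h')))) =
      bitSign (w * t + w' * t' + g * (t + t' + u) + h * m + h' * m') * 4 *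
        bellDiagonal D ![y₀, y₁] ![a, b] := by
  trans bitSign (w * t + w' * t' + g * (t + t' + u) + h * m + h' * m') *
    bitSign (g * (a + b + (y₀ + y₁))) * ∑ p, ∑ q, D (a + b) (p + q) *
      (bitSign (p * (a + y₀)) * bitSign (q * (b + y₁)))
  swap
  · rw [sum_bellPhase]
    linear_combination 4 * bitSign (w * t + w' * t' + g * (t + t' + u) + h * m + h' * m') *
      bitSign_mul_bellDiagonal D g y₀ y₁ a b
  -- The outcomes `r` and `w` put the sign of `(r + w) * a` on the state, which acts as a shift of
  -- the `X`-label; `m` is the shift from copying that label.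
  rw [sum_add_right _ (r + w + m), Finset.mul_sum]
  refine Finset.sum_congr rfl fun p _ => ?_
  rw [sum_add_right _ (r' + w' + m'), Finset.mul_sum]
  refine Finset.sum_congr rfl fun q _ => ?_
  have h3 := congrArg bitSign
    (phase_identity a b p q s s' t t' u r r' w w' g h h' m m' y₀ y₁)
  rw [parity_identity, shift_identity]
  simp only [bitSign_add] at h3 ⊢
  linear_combination (D (a + b) (p + q)) * h3

theorem outputCorrection_mul_outputMeasurement (A : Matrix (Fin 2) (Fin 2) ℂ) (g k l : Fin 2)
    (j x : Fin 1 → Fin 2) (z : Fin 2 → Fin 2) :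
    (outputCorrection A g k l * outputMeasurement j) x z =
      1 / 2 * ∑ y, A (x 0) y * (bitSign ((z 1 + j 0) * z 0) * (bitSign (g * y) *
        bitSign (y * (z 1 + j 0 + k)) * bitSign ((z 1 + j 0) * l))) := by
  rw [Matrix.mul_apply, sum_one_bit, Finset.sum_eq_single (z 1 + j 0)]
  · have : z 1 = z 1 + j 0 + j 0 := (add_add_cancel_right _ _).symm
    simp only [outputCorrection, outputMeasurement, Matrix.of_apply, Matrix.cons_val, ← this,
      if_true, Finset.sum_mul, Finset.mul_sum, ← invSqrtTwo_mul_self]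
    refine Finset.sum_congr rfl fun y _ => ?_
    ring
  · intro p _ hp
    have : z 1 ≠ p + j 0 := fun h => hp (by rw [h, add_add_cancel_right])
    simp [outputMeasurement, this]
  · simp

/-- The measurements at `i₁`, `i₂`, `n₁` tie three of the seven edge bits to the others. What
remains are the two computational bits `a`, `b` and the bits `x`, `x'` of the edges from `n₂` to the
outputs. -/
theorem sum_seven_bits_of_parity {M : Type*} [AddCommMonoid M] (f : (Fin 7 → Fin 2) → M)
    (s t s' t' u : Fin 2)
    (hf : ∀ e, f e ≠ 0 → e 1 = e 0 + s + t ∧ e 3 = e 2 + s' + t' ∧ e 4 = e 1 + e 3 + u) :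
    ∑ e, f e = ∑ a, ∑ b, ∑ x, ∑ x',
      f ![a + s, a + t, b + s', b + t', a + t + (b + t') + u, x, x'] := by
  have h0 (e : Fin 7 → Fin 2) (h : ¬(e 1 = e 0 + s + t ∧ e 3 = e 2 + s' + t' ∧
      e 4 = e 1 + e 3 + u)) : f e = 0 := by
    by_contra h'
    exact h (hf e h')
  rw [sum_seven_bits, sum_add_right _ s]
  refine Finset.sum_congr rfl fun a _ => ?_
  rw [Finset.sum_eq_single (a + t), sum_add_right _ s']
  rotate_left
  · intro c _ hc
    refine Finset.sum_eq_zero fun _ _ => Finset.sum_eq_zero fun _ _ => Finset.sum_eq_zero fun _ _ =>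
      Finset.sum_eq_zero fun _ _ => Finset.sum_eq_zero fun _ _ => h0 _ fun h => hc ?_
    simpa [add_add_cancel_right] using h.1
  · simp
  refine Finset.sum_congr rfl fun b _ => ?_
  rw [Finset.sum_eq_single (b + t'), Finset.sum_eq_single (a + t + (b + t') + u)]
  · intro c _ hc
    refine Finset.sum_eq_zero fun _ _ => Finset.sum_eq_zero fun _ _ => h0 _ fun h => hc ?_
    simpa using h.2.2
  · simp
  · intro c _ hc
    refine Finset.sum_eq_zero fun _ _ => Finset.sum_eq_zero fun _ _ => Finset.sum_eq_zero fun _ _ =>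
      h0 _ fun h => hc ?_
    simpa [add_add_cancel_right] using h.2.1
  · simp

/-- The amplitude of one branch of the protocol, before the powers of `2` are collected. -/
theorem sum_butterfly_amplitude (A B : Fin 2 → Matrix (Fin 2) (Fin 2) ℂ) (D : Fin 2 → Fin 2 → ℂ)
    (ψ : (Fin 2 → Fin 2) → ℂ) (j₁ j₂ j₃ j₄ : Fin 3 → Fin 2) (m m' : Fin 1 → Fin 2)
    (x₀ x₁ : Fin 1 → Fin 2) (z : Fin 0 → Fin 2) :
    ∑ e : Fin 7 → Fin 2, ∑ i : Fin 2 → Fin 2,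
      inputMeasurement (B 0) j₁ z ![i 0, e 0, e 1] *
      inputMeasurement (B 1) j₂ z ![i 1, e 2, e 3] *
      parityMeasurement j₃ z ![e 1, e 3, e 4] *
      phaseMeasurement D (j₁ 1 + j₂ 1 + j₃ 0)
        (j₁ 2 + j₃ 1 + m 0 + (j₂ 2 + j₃ 2 + m' 0)) j₄ z ![e 4, e 5, e 6] *
      (outputCorrection (A 0) (j₄ 0) (j₁ 2 + j₃ 1) (j₁ 0 + j₄ 1) * outputMeasurement m) x₀
        ![e 0, e 5] *
      (outputCorrection (A 1) (j₄ 0) (j₂ 2 + j₃ 2) (j₂ 0 + j₄ 2) * outputMeasurement m') x₁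
        ![e 2, e 6] * ψ i =
      invSqrtTwo ^ 5 * (1 / 2) * bitSign (j₃ 1 * j₁ 1 + j₃ 2 * j₂ 1 +
        j₄ 0 * (j₁ 1 + j₂ 1 + j₃ 0) + j₄ 1 * m 0 + j₄ 2 * m' 0) *
        ((tensorOp A * bellDiagonal D * tensorOp B) *ᵥ ψ) ![x₀ 0, x₁ 0] := by
  rw [sum_seven_bits_of_parity _ (j₁ 0) (j₁ 1) (j₂ 0) (j₂ 1) (j₃ 0)]
  rotate_left
  · intro e he
    by_contra h
    refine he (Finset.sum_eq_zero fun i _ => ?_)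
    rw [not_and_or, not_and_or] at h
    rcases h with h | h | h <;> simp [inputMeasurement, parityMeasurement, h]
  set core : Fin 2 → Fin 2 → Fin 2 → Fin 2 → Fin 2 → Fin 2 → ℂ := fun a b y₀ y₁ x x' =>
    bitSign (j₁ 2 * a) * bitSign (j₂ 2 * b) * (bitSign (j₃ 1 * (a + j₁ 1)) *
      bitSign (j₃ 2 * (b + j₂ 1))) *
      (D (a + j₁ 1 + (b + j₂ 1) + j₃ 0 + (j₁ 1 + j₂ 1 + j₃ 0))
          (x + x' + (j₁ 2 + j₃ 1 + m 0 + (j₂ 2 + j₃ 2 + m' 0))) *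
        bitSign (j₄ 0 * (a + j₁ 1 + (b + j₂ 1) + j₃ 0)) * bitSign (j₄ 1 * x) *
          bitSign (j₄ 2 * x')) *
      (bitSign ((x + m 0) * (a + j₁ 0)) * (bitSign (j₄ 0 * y₀) *
        bitSign (y₀ * (x + m 0 + (j₁ 2 + j₃ 1))) * bitSign ((x + m 0) * (j₁ 0 + j₄ 1)))) *
      (bitSign ((x' + m' 0) * (b + j₂ 0)) * (bitSign (j₄ 0 * y₁) *
        bitSign (y₁ * (x' + m' 0 + (j₂ 2 + j₃ 2))) * bitSign ((x' + m' 0) * (j₂ 0 + j₄ 2))))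
    with hcore
  set Φ : Fin 2 → Fin 2 → ℂ := fun a b => ∑ i, B 0 a (i 0) * B 1 b (i 1) * ψ i with hΦ
  -- The factor `1/8` is `1/2` from the first repeater and `1/2` from each output node; the `4` of
  -- `sum_bellPhase` later turns it into `1/2`.
  have hstep (a b x x' : Fin 2) : ∑ i : Fin 2 → Fin 2,
      inputMeasurement (B 0) j₁ z ![i 0, a + j₁ 0, a + j₁ 1] *
      inputMeasurement (B 1) j₂ z ![i 1, b + j₂ 0, b + j₂ 1] *
      parityMeasurement j₃ z ![a + j₁ 1, b + j₂ 1, a + j₁ 1 + (b + j₂ 1) + j₃ 0] *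
      phaseMeasurement D (j₁ 1 + j₂ 1 + j₃ 0)
        (j₁ 2 + j₃ 1 + m 0 + (j₂ 2 + j₃ 2 + m' 0)) j₄ z
        ![a + j₁ 1 + (b + j₂ 1) + j₃ 0, x, x'] *
      (outputCorrection (A 0) (j₄ 0) (j₁ 2 + j₃ 1) (j₁ 0 + j₄ 1) * outputMeasurement m) x₀
        ![a + j₁ 0, x] *
      (outputCorrection (A 1) (j₄ 0) (j₂ 2 + j₃ 2) (j₂ 0 + j₄ 2) * outputMeasurement m') x₁
        ![b + j₂ 0, x'] * ψ i =
      ∑ y₀, ∑ y₁, invSqrtTwo ^ 5 * (1 / 8) * (A 0 (x₀ 0) y₀ * A 1 (x₁ 0) y₁) * Φ a b *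
        core a b y₀ y₁ x x' := by
    simp only [outputCorrection_mul_outputMeasurement, inputMeasurement, parityMeasurement,
      phaseMeasurement, Matrix.of_apply, Matrix.cons_val, add_add_cancel_right, if_true, mul_one]
    set S₀ := ∑ y, A 0 (x₀ 0) y * (bitSign ((x + m 0) * (a + j₁ 0)) * (bitSign (j₄ 0 * y) *
      bitSign (y * (x + m 0 + (j₁ 2 + j₃ 1))) * bitSign ((x + m 0) * (j₁ 0 + j₄ 1)))) with hS₀
    set S₁ := ∑ y, A 1 (x₁ 0) y * (bitSign ((x' + m' 0) * (b + j₂ 0)) * (bitSign (j₄ 0 * y) *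
      bitSign (y * (x' + m' 0 + (j₂ 2 + j₃ 2))) * bitSign ((x' + m' 0) * (j₂ 0 + j₄ 2))))
      with hS₁
    trans invSqrtTwo ^ 5 * (1 / 8) * Φ a b * (bitSign (j₁ 2 * a) * bitSign (j₂ 2 * b) *
      (bitSign (j₃ 1 * (a + j₁ 1)) * bitSign (j₃ 2 * (b + j₂ 1))) *
      (D (a + j₁ 1 + (b + j₂ 1) + j₃ 0 + (j₁ 1 + j₂ 1 + j₃ 0))
          (x + x' + (j₁ 2 + j₃ 1 + m 0 + (j₂ 2 + j₃ 2 + m' 0))) *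
        bitSign (j₄ 0 * (a + j₁ 1 + (b + j₂ 1) + j₃ 0)) * bitSign (j₄ 1 * x) *
          bitSign (j₄ 2 * x'))) * (S₀ * S₁)
    · simp only [hΦ, Finset.mul_sum, Finset.sum_mul]
      refine Finset.sum_congr rfl fun i _ => ?_
      ring
    · rw [hS₀, hS₁, Finset.sum_mul_sum, Finset.mul_sum]
      refine Finset.sum_congr rfl fun y₀ _ => ?_
      rw [Finset.mul_sum]
      refine Finset.sum_congr rfl fun y₁ _ => ?_
      simp only [hcore]
      ring
  have key (a b y₀ y₁ : Fin 2) : ∑ x, ∑ x', core a b y₀ y₁ x x' = _ :=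
    sum_butterfly_phases D a b (j₁ 0) (j₂ 0) (j₁ 1) (j₂ 1) (j₃ 0) (j₁ 2)
      (j₂ 2) (j₃ 1) (j₃ 2) (j₄ 0) (j₄ 1) (j₄ 2) (m 0) (m' 0) y₀ y₁
  have hab (a b : Fin 2) : ∑ x, ∑ x', ∑ y₀, ∑ y₁, invSqrtTwo ^ 5 * (1 / 8) *
      (A 0 (x₀ 0) y₀ * A 1 (x₁ 0) y₁) * Φ a b * core a b y₀ y₁ x x' =
      ∑ y₀, ∑ y₁, invSqrtTwo ^ 5 * (1 / 8) * (A 0 (x₀ 0) y₀ * A 1 (x₁ 0) y₁) * Φ a b *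
        ∑ x, ∑ x', core a b y₀ y₁ x x' := by
    simp only [Fin.sum_univ_two]
    ring
  calc _ = ∑ a, ∑ b, ∑ x, ∑ x', ∑ y₀, ∑ y₁, invSqrtTwo ^ 5 * (1 / 8) *
      (A 0 (x₀ 0) y₀ * A 1 (x₁ 0) y₁) * Φ a b * core a b y₀ y₁ x x' :=
        Finset.sum_congr rfl fun a _ => Finset.sum_congr rfl fun b _ =>
          Finset.sum_congr rfl fun x _ => Finset.sum_congr rfl fun x' _ => hstep a b x x'
    _ = _ := by
      have hB (a b : Fin 2) : (tensorOp B *ᵥ ψ) ![a, b] = Φ a b := by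
        simp [Matrix.mulVec, dotProduct, tensorOp, hΦ]
      have hAD (y₀ y₁ : Fin 2) : tensorOp A ![x₀ 0, x₁ 0] ![y₀, y₁] =
          A 0 (x₀ 0) y₀ * A 1 (x₁ 0) y₁ := by
        simp [tensorOp]
      have hR : ((tensorOp A * bellDiagonal D * tensorOp B) *ᵥ ψ) ![x₀ 0, x₁ 0] =
          ∑ y₀, ∑ y₁, A 0 (x₀ 0) y₀ * A 1 (x₁ 0) y₁ *
            ∑ a, ∑ b, bellDiagonal D ![y₀, y₁] ![a, b] * Φ a b := by
        have hBD (v : (Fin 2 → Fin 2) → ℂ) (y : Fin 2 → Fin 2) :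
            (bellDiagonal D *ᵥ v) y = ∑ a, ∑ b, bellDiagonal D y ![a, b] * v ![a, b] := by
          rw [Matrix.mulVec, dotProduct, sum_two_bits]
        rw [← Matrix.mulVec_mulVec, ← Matrix.mulVec_mulVec, Matrix.mulVec, dotProduct,
          sum_two_bits]
        simp only [hAD, hBD, hB]
      simp only [hab, key, hR]
      simp only [Fin.sum_univ_two]
      ring

/-! ### The protocol on the butterfly network -/

namespace ButterflyNode

/-- The number of qubits that a node of the butterfly network holds at the beginning. -/
def startSize : ButterflyNode → ℕ
  | i₁ | i₂ | n₁ | n₂ => 3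
  | o₁ | o₂ => 2

/-- The number of qubits that a node of the butterfly network keeps after the first round. -/
def middleSize : ButterflyNode → ℕ
  | i₁ | i₂ | n₁ => 0
  | n₂ => 3
  | o₁ | o₂ => 1

/-- The number of qubits that a node of the butterfly network holds at the end. -/
def endSize : ButterflyNode → ℕ
  | i₁ | i₂ | n₁ | n₂ => 0
  | o₁ | o₂ => 1

/-- The number of bits that a node of the butterfly network announces in the first round. -/
def firstOutcomeSize : ButterflyNode → ℕ
  | i₁ | i₂ | n₁ => 3
  | n₂ => 0
  | o₁ | o₂ => 1

/-- The number of bits that a node of the butterfly network announces in the second round. -/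
def secondOutcomeSize : ButterflyNode → ℕ
  | n₂ => 3
  | _ => 0

/-- The qubits held by a node of the butterfly network at the beginning. -/
def startQubit : ∀ v, Fin (startSize v) → (Fin 7 × Fin 2) ⊕ Fin 2
  | i₁ => ![.inr 0, .inl (0, 0), .inl (1, 0)]
  | i₂ => ![.inr 1, .inl (2, 0), .inl (3, 0)]
  | n₁ => ![.inl (1, 1), .inl (3, 1), .inl (4, 0)]
  | n₂ => ![.inl (4, 1), .inl (5, 0), .inl (6, 0)]
  | o₁ => ![.inl (0, 1), .inl (5, 1)]
  | o₂ => ![.inl (2, 1), .inl (6, 1)]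

/-- The qubits held by a node of the butterfly network at the end. -/
def endQubit : ∀ v, Fin (endSize v) → Fin 2
  | i₁ | i₂ | n₁ | n₂ => ![]
  | o₁ => ![0]
  | o₂ => ![1]

/-- The bits of a node of the butterfly network at the beginning, in order. -/
noncomputable def readStart (v : ButterflyNode) :
    LocalBasis butterfly.startLoc v ≃ (Fin (startSize v) → Fin 2) :=
  (Equiv.ofBijective (fun k => (⟨startQubit v k, by revert k; cases v <;> decide⟩ :
      {q // butterfly.startLoc q = v}))
    ⟨fun k l h => by
      have h' : startQubit v k = startQubit v l := congrArg Subtype.val h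
      revert k l
      cases v <;> decide,
    fun ⟨q, hq⟩ => by
      have : ∃ k, startQubit v k = q := by
        revert q
        cases v <;> decide
      exact this.imp fun k hk => Subtype.ext hk⟩).symm.arrowCongr (Equiv.refl _)

/-- The bits of a node of the butterfly network at the end, in order. -/
noncomputable def readEnd (v : ButterflyNode) :
    LocalBasis butterfly.output v ≃ (Fin (endSize v) → Fin 2) :=
  (Equiv.ofBijective (fun k => (⟨endQubit v k, by revert k; cases v <;> decide⟩ :
      {q // butterfly.output q = v}))
    ⟨fun k l h => by
      revert k l
      cases v <;> decide,
    fun ⟨q, hq⟩ => by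
      have : ∃ k, endQubit v k = q := by
        revert q
        cases v <;> decide
      exact this.imp fun k hk => Subtype.ext hk⟩).symm.arrowCongr (Equiv.refl _)

theorem prod_univ (f : ButterflyNode → ℂ) :
    ∏ v, f v = f i₁ * f i₂ * f n₁ * f n₂ * f o₁ * f o₂ := by
  have : (Finset.univ : Finset ButterflyNode) = {i₁, i₂, n₁, n₂, o₁, o₂} := rfl
  rw [this]
  simp [mul_assoc]

variable (A B : Fin 2 → Matrix (Fin 2) (Fin 2) ℂ) (D : Fin 2 → Fin 2 → ℂ)

/-- The measurements of the first round. -/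
noncomputable def firstRound : ∀ v, (Fin (firstOutcomeSize v) → Fin 2) →
    Matrix (Fin (middleSize v) → Fin 2) (Fin (startSize v) → Fin 2) ℂ
  | i₁ => inputMeasurement (B 0)
  | i₂ => inputMeasurement (B 1)
  | n₁ => parityMeasurement
  | n₂ => fun _ => (1 : Matrix (Fin 3 → Fin 2) (Fin 3 → Fin 2) ℂ)
  | o₁ => outputMeasurement
  | o₂ => outputMeasurement

/-- The measurement of the second repeater in the second round, when the outcomes of the first
round are given. -/
noncomputable def phaseRound (j₁ j₂ j₃ : Fin 3 → Fin 2) (m m' : Fin 1 → Fin 2) :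
    (Fin 3 → Fin 2) → Matrix (Fin 0 → Fin 2) (Fin 3 → Fin 2) ℂ :=
  phaseMeasurement D (j₁ 1 + j₂ 1 + j₃ 0) (j₁ 2 + j₃ 1 + m 0 + (j₂ 2 + j₃ 2 + m' 0))

/-- The measurements of the second round. -/
noncomputable def secondRound (j : ∀ v, Fin (firstOutcomeSize v) → Fin 2) :
    ∀ v, (Fin (secondOutcomeSize v) → Fin 2) →
      Matrix (Fin (endSize v) → Fin 2) (Fin (middleSize v) → Fin 2) ℂ
  | i₁ => fun _ => (1 : Matrix (Fin 0 → Fin 2) (Fin 0 → Fin 2) ℂ)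
  | i₂ => fun _ => (1 : Matrix (Fin 0 → Fin 2) (Fin 0 → Fin 2) ℂ)
  | n₁ => fun _ => (1 : Matrix (Fin 0 → Fin 2) (Fin 0 → Fin 2) ℂ)
  | n₂ => phaseRound D (j i₁) (j i₂) (j n₁) (j o₁) (j o₂)
  | o₁ => fun _ => (1 : Matrix (Fin 1 → Fin 2) (Fin 1 → Fin 2) ℂ)
  | o₂ => fun _ => (1 : Matrix (Fin 1 → Fin 2) (Fin 1 → Fin 2) ℂ)

/-- The correction at the first output node. -/
noncomputable def firstCorrection (A : Matrix (Fin 2) (Fin 2) ℂ) (j₁ j₃ j₄ : Fin 3 → Fin 2) :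
    Matrix (Fin 1 → Fin 2) (Fin 1 → Fin 2) ℂ :=
  outputCorrection A (j₄ 0) (j₁ 2 + j₃ 1) (j₁ 0 + j₄ 1)

/-- The correction at the second output node. -/
noncomputable def secondCorrection (A : Matrix (Fin 2) (Fin 2) ℂ) (j₂ j₃ j₄ : Fin 3 → Fin 2) :
    Matrix (Fin 1 → Fin 2) (Fin 1 → Fin 2) ℂ :=
  outputCorrection A (j₄ 0) (j₂ 2 + j₃ 2) (j₂ 0 + j₄ 2)

/-- The corrections of the third round. -/
noncomputable def thirdRound (j : ∀ v, Fin (firstOutcomeSize v) → Fin 2)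
    (j' : ∀ v, Fin (secondOutcomeSize v) → Fin 2) :
    ∀ v, Matrix (Fin (endSize v) → Fin 2) (Fin (endSize v) → Fin 2) ℂ
  | i₁ => 1
  | i₂ => 1
  | n₁ => 1
  | n₂ => 1
  | o₁ => firstCorrection (A 0) (j i₁) (j n₁) (j' n₂)
  | o₂ => secondCorrection (A 1) (j i₂) (j n₁) (j' n₂)

/-- The sign of the amplitude of a branch, in terms of the outcomes. -/
noncomputable def branchSign (j₁ j₂ j₃ j₄ : Fin 3 → Fin 2) (m m' : Fin 1 → Fin 2) : ℂ :=
  bitSign (j₃ 1 * j₁ 1 + j₃ 2 * j₂ 1 + j₄ 0 * (j₁ 1 + j₂ 1 + j₃ 0) + j₄ 1 * m 0 + j₄ 2 * m' 0)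

variable {A B D}

theorem firstRound_complete (hB : ∀ i, B i ∈ Matrix.unitaryGroup (Fin 2) ℂ) (v : ButterflyNode) :
    ∑ j, (firstRound B v j)ᴴ * firstRound B v j = 1 := by
  have h (n : ℕ) : ∑ j : Fin 0 → Fin 2, (1 : Matrix (Fin n → Fin 2) (Fin n → Fin 2) ℂ)ᴴ * 1 = 1 := by
    simp
  cases v
  · exact inputMeasurement_complete (hB 0)
  · exact inputMeasurement_complete (hB 1)
  · exact parityMeasurement_complete
  · exact h 3
  · exact outputMeasurement_complete
  · exact outputMeasurement_complete

theorem secondRound_complete (hD : ∀ p q, ‖D p q‖ = 1) (j : ∀ v, Fin (firstOutcomeSize v) → Fin 2)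
    (v : ButterflyNode) :
    ∑ j', (secondRound D j v j')ᴴ * secondRound D j v j' = 1 := by
  have h (n : ℕ) : ∑ j : Fin 0 → Fin 2, (1 : Matrix (Fin n → Fin 2) (Fin n → Fin 2) ℂ)ᴴ * 1 = 1 := by
    simp
  cases v
  · exact h 0
  · exact h 0
  · exact h 0
  · exact phaseMeasurement_complete hD _ _
  · exact h 1
  · exact h 1

theorem thirdRound_isometry (hA : ∀ i, A i ∈ Matrix.unitaryGroup (Fin 2) ℂ)
    (j : ∀ v, Fin (firstOutcomeSize v) → Fin 2) (j' : ∀ v, Fin (secondOutcomeSize v) → Fin 2)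
    (v : ButterflyNode) : (thirdRound A j j' v)ᴴ * thirdRound A j j' v = 1 := by
  cases v
  · exact (by simp : (1 : Matrix (Fin 0 → Fin 2) (Fin 0 → Fin 2) ℂ)ᴴ * 1 = 1)
  · exact (by simp : (1 : Matrix (Fin 0 → Fin 2) (Fin 0 → Fin 2) ℂ)ᴴ * 1 = 1)
  · exact (by simp : (1 : Matrix (Fin 0 → Fin 2) (Fin 0 → Fin 2) ℂ)ᴴ * 1 = 1)
  · exact (by simp : (1 : Matrix (Fin 0 → Fin 2) (Fin 0 → Fin 2) ℂ)ᴴ * 1 = 1)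
  · exact outputCorrection_isometry (hA 0) _ _ _
  · exact outputCorrection_isometry (hA 1) _ _ _

/-- The rounds announce `11` and `3` bits, giving `2 ^ 14 = 128 ^ 2` equally likely branches. -/
theorem sum_branchWeight :
    ∑ j : ∀ v, Fin (firstOutcomeSize v) → Fin 2, ∑ j' : ∀ v, Fin (secondOutcomeSize v) → Fin 2,
      (1 / 128 * branchSign (j i₁) (j i₂) (j n₁) (j' n₂) (j o₁) (j o₂)) *
        star (1 / 128 * branchSign (j i₁) (j i₂) (j n₁) (j' n₂) (j o₁) (j o₂)) = 1 := by
  have h (x : ℂ) (hx : x * x = 1) (hx' : star x = x) :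
      (1 / 128 * x) * star (1 / 128 * x) = 1 / 16384 := by
    have h128 : star (1 / 128 : ℂ) = 1 / 128 := by simp
    rw [star_mul', hx', h128]
    linear_combination 1 / 16384 * hx
  simp only [branchSign, h _ (bitSign_mul_self _) (star_bitSign _), Finset.sum_const,
    Finset.card_univ, Fintype.card_pi, smul_smul, Fintype.card_fin, Finset.prod_const]
  have h1 : ∏ v, 2 ^ firstOutcomeSize v = 2 ^ 11 := rfl
  have h2 : ∏ v, 2 ^ secondOutcomeSize v = 2 ^ 3 := rfl
  rw [h1, h2]
  norm_num

/-- Contracting the local operators along the edges reduces this to `sum_butterfly_amplitude`. -/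
theorem branch_mulVec (ψ : (Fin 2 → Fin 2) → ℂ) (j : ∀ v, Fin (firstOutcomeSize v) → Fin 2)
    (j' : ∀ v, Fin (secondOutcomeSize v) → Fin 2) :
    tensorOp (fun v => (thirdRound A j j' v).submatrix (readEnd v) id * secondRound D j v (j' v) *
      (firstRound B v (j v)).submatrix id (readStart v)) *ᵥ
        (Network.startVec ψ ∘ glue butterfly.startLoc) =
      (1 / 128 * branchSign (j i₁) (j i₂) (j n₁) (j' n₂) (j o₁) (j o₂)) •
        (((tensorOp A * bellDiagonal D * tensorOp B) *ᵥ ψ) ∘ glue butterfly.output) := by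
  have hM (v : ButterflyNode) : (thirdRound A j j' v).submatrix (readEnd v) id *
      secondRound D j v (j' v) * (firstRound B v (j v)).submatrix id (readStart v) =
      (thirdRound A j j' v * secondRound D j v (j' v) * firstRound B v (j v)).submatrix
        (readEnd v) (readStart v) := by
    rw [Matrix.submatrix_mul _ _ _ id _ Function.bijective_id,
      Matrix.submatrix_mul _ _ _ id _ Function.bijective_id]
    rfl
  simp only [hM]
  funext x
  rw [Network.tensorOp_mulVec_startVec]
  simp only [prod_univ, Matrix.submatrix_apply]
  have e₁ : thirdRound A j j' i₁ * secondRound D j i₁ (j' i₁) * firstRound B i₁ (j i₁) =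
      inputMeasurement (B 0) (j i₁) :=
    (by simp : (1 : Matrix (Fin 0 → Fin 2) (Fin 0 → Fin 2) ℂ) * 1 * inputMeasurement (B 0) (j i₁)
      = _)
  have e₂ : thirdRound A j j' i₂ * secondRound D j i₂ (j' i₂) * firstRound B i₂ (j i₂) =
      inputMeasurement (B 1) (j i₂) :=
    (by simp : (1 : Matrix (Fin 0 → Fin 2) (Fin 0 → Fin 2) ℂ) * 1 * inputMeasurement (B 1) (j i₂)
      = _)
  have e₃ : thirdRound A j j' n₁ * secondRound D j n₁ (j' n₁) * firstRound B n₁ (j n₁) =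
      parityMeasurement (j n₁) :=
    (by simp : (1 : Matrix (Fin 0 → Fin 2) (Fin 0 → Fin 2) ℂ) * 1 * parityMeasurement (j n₁) = _)
  have e₄ : thirdRound A j j' n₂ * secondRound D j n₂ (j' n₂) * firstRound B n₂ (j n₂) =
      phaseRound D (j i₁) (j i₂) (j n₁) (j o₁) (j o₂) (j' n₂) :=
    (by simp : (1 : Matrix (Fin 0 → Fin 2) (Fin 0 → Fin 2) ℂ) *
      phaseRound D (j i₁) (j i₂) (j n₁) (j o₁) (j o₂) (j' n₂) *
        (1 : Matrix (Fin 3 → Fin 2) (Fin 3 → Fin 2) ℂ) = _)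
  have e₅ : thirdRound A j j' o₁ * secondRound D j o₁ (j' o₁) * firstRound B o₁ (j o₁) =
      firstCorrection (A 0) (j i₁) (j n₁) (j' n₂) * outputMeasurement (j o₁) :=
    (by simp : firstCorrection (A 0) (j i₁) (j n₁) (j' n₂) *
      (1 : Matrix (Fin 1 → Fin 2) (Fin 1 → Fin 2) ℂ) * outputMeasurement (j o₁) = _)
  have e₆ : thirdRound A j j' o₂ * secondRound D j o₂ (j' o₂) * firstRound B o₂ (j o₂) =
      secondCorrection (A 1) (j i₂) (j n₁) (j' n₂) * outputMeasurement (j o₂) :=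
    (by simp : secondCorrection (A 1) (j i₂) (j n₁) (j' n₂) *
      (1 : Matrix (Fin 1 → Fin 2) (Fin 1 → Fin 2) ℂ) * outputMeasurement (j o₂) = _)
  have hout : ![readEnd o₁ (x o₁) (0 : Fin 1), readEnd o₂ (x o₂) (0 : Fin 1)] =
      glue butterfly.output x := by
    funext k
    fin_cases k <;> rfl
  -- Seven factors come from the Bell pairs, two from the input nodes and three from the second
  -- repeater; the remaining `1/2` makes `1/128`.
  have hconst : invSqrtTwo ^ 7 * invSqrtTwo ^ 5 = 1 / 64 := by
    calc _ = (invSqrtTwo * invSqrtTwo) ^ 6 := by ring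
      _ = _ := by
        rw [invSqrtTwo_mul_self]
        norm_num
  have hsum := sum_butterfly_amplitude A B D ψ (j i₁) (j i₂) (j n₁) (j' n₂) (j o₁) (j o₂)
    (readEnd o₁ (x o₁)) (readEnd o₂ (x o₂)) ![]
  refine (congrArg _ (Finset.sum_congr rfl fun b _ => Finset.sum_congr rfl fun i _ =>
    congrArg (· * ψ i) ?_)).trans ((congrArg _ hsum).trans ?_)
  · rw [e₁, e₂, e₃, e₄, e₅, e₆]
    refine congrArg₂ (· * ·) (congrArg₂ (· * ·) (congrArg₂ (· * ·) (congrArg₂ (· * ·)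
      (congrArg₂ (· * ·) ?_ ?_) ?_) ?_) ?_) ?_
    · exact congrArg₂ (inputMeasurement (B 0) (j i₁)) (Subsingleton.elim (α := Fin 0 → Fin 2) _ _)
        (three_bits_eta _)
    · exact congrArg₂ (inputMeasurement (B 1) (j i₂)) (Subsingleton.elim (α := Fin 0 → Fin 2) _ _)
        (three_bits_eta _)
    · exact congrArg₂ (parityMeasurement (j n₁)) (Subsingleton.elim (α := Fin 0 → Fin 2) _ _)
        (three_bits_eta _)
    · exact congrArg₂ (phaseRound D (j i₁) (j i₂) (j n₁) (j o₁) (j o₂) (j' n₂))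
        (Subsingleton.elim (α := Fin 0 → Fin 2) _ _) (three_bits_eta _)
    · exact congrArg ((firstCorrection (A 0) (j i₁) (j n₁) (j' n₂) * outputMeasurement (j o₁)) _)
        (two_bits_eta _)
    · exact congrArg ((secondCorrection (A 1) (j i₂) (j n₁) (j' n₂) * outputMeasurement (j o₂)) _)
        (two_bits_eta _)
  · rw [hout]
    simp only [Pi.smul_apply, Function.comp_apply, smul_eq_mul, Fintype.card_fin, branchSign]
    rw [← invSqrtTwo]
    linear_combination (1 / 2 * bitSign (j n₁ (1 : Fin 3) * j i₁ (1 : Fin 3) +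
      j n₁ (2 : Fin 3) * j i₂ (1 : Fin 3) + j' n₂ (0 : Fin 3) * (j i₁ (1 : Fin 3) +
        j i₂ (1 : Fin 3) + j n₁ (0 : Fin 3)) + j' n₂ (1 : Fin 3) * j o₁ (0 : Fin 1) +
        j' n₂ (2 : Fin 3) * j o₂ (0 : Fin 1)) *
      ((tensorOp A * bellDiagonal D * tensorOp B) *ᵥ ψ) (glue butterfly.output x)) * hconst

theorem butterfly_deterministicallyImplementable {U : Matrix (Fin 2 → Fin 2) (Fin 2 → Fin 2) ℂ}
    (hU : U ∈ Matrix.unitaryGroup (Fin 2 → Fin 2) ℂ) :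
    butterfly.DeterministicallyImplementable U := by
  obtain ⟨A, B, D, hA, hB, hD, rfl⟩ := exists_tensorOp_mul_bellDiagonal_mul_tensorOp hU
  refine Network.deterministicallyImplementable_of_three_rounds butterfly _
    (fun v j => (firstRound B v j).submatrix id (readStart v)) (fun j v j' => secondRound D j v j')
    (fun j j' v => (thirdRound A j j' v).submatrix (readEnd v) id) (fun v => ?_)
    (fun j v => secondRound_complete hD j v) (fun j j' v => ?_)
    (fun j j' => 1 / 128 * branchSign (j i₁) (j i₂) (j n₁) (j' n₂) (j o₁) (j o₂))
    sum_branchWeight fun j j' ψ => branch_mulVec ψ j j'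
  · have h := congrArg (fun M => M.submatrix (readStart v) (readStart v))
      (firstRound_complete hB v)
    simp only [Matrix.submatrix_one_equiv] at h
    rw [← h]
    ext x y
    simp only [Matrix.sum_apply, Matrix.submatrix_apply]
    rfl
  · rw [Matrix.conjTranspose_submatrix]
    have h := thirdRound_isometry hA j j' v
    rw [← Matrix.submatrix_mul _ _ _ _ _ (readEnd v).bijective, h, Matrix.submatrix_id_id]

end ButterflyNode

end QuantumNetwork

theorem theorem1 (U : Matrix (Fin 2 → Fin 2) (Fin 2 → Fin 2) ℂ)
    (hU : U ∈ Matrix.unitaryGroup (Fin 2 → Fin 2) ℂ) :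
    QuantumNetwork.butterfly.DeterministicallyImplementable U :=
  QuantumNetwork.ButterflyNode.butterfly_deterministicallyImplementable hU
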